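/- For $n\ge 4$ let $S_n$ act on the space of real $n\times n$ matrices, with scalar product $\langle a,b\rangle=\sum_{i,j}a_{ij}b_{ij}$ and the corresponding Euclidean norm, by $(ga)_{ij}=a_{g^{-1}(i)g^{-1}(j)}$. Let $v$ be the matrix with $v_{ij}=1$ if $i-j\equiv\pm1 \pmod n$ and $v_{ij}=0$ otherwise, and let $ST_n=\operatorname{conv}\{gv: g\in S_n\}$ be the symmetric Traveling Salesman Polytope (the convex hull of the adjacency matrices of the Hamiltonian cycles of the complete graph on $n$ vertices). Let $c$ be the matrix with $c_{ii}=0$ and $c_{ij}=2/(n-1)$ for $i\ne j$. Ellipsoids, balls and volumes below are taken in the affine hull of $ST_n$. (1) The affine hull of $ST_n$ consists of the symmetric matrices with zero diagonal and all row and column sums equal to $2$, and $\dim ST_n=(n^2-3n)/2$. (2) The unique ellipsoid of minimum volume containing $ST_n$ is the ball centered at $c$ of radius $\sqrt{2n(n-3)/(n-1)}$. (3) If $n\ge5$, the symmetry coefficient of $ST_n$ with respect to $c$, that is, the largest $\alpha>0$ such that $c-\alpha(x-c)\in ST_n$ for all $x\in ST_n$, equals $2/(n-3)$. (4) If $n\ge5$,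 the unique ellipsoid of maximum volume contained in $ST_n$ is the ball centered at $c$ of radius $\sqrt{8/((n-1)(n-3))}$. -/

import Mathlib

open MeasureTheory Module

noncomputable section

/-- The space of real `n × n` matrices with the scalar product `⟨a, b⟩ = ∑ i, j, a i j * b i j`;
the entry of `a` in row `i` and column `j` is `a (i, j)`. -/
abbrev MatSpace (n : ℕ) : Type := EuclideanSpace ℝ (Fin n × Fin n)

/-- The action of `S_n` by simultaneous permutations of rows and columns:
`(g a) i j = a (g⁻¹ i) (g⁻¹ j)`. -/
def permAct {n : ℕ} (g : Equiv.Perm (Fin n)) (a : MatSpace n) : MatSpace n :=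
  WithLp.toLp 2 fun p => a (g⁻¹ p.1, g⁻¹ p.2)

/-- The adjacency matrix of the standard Hamiltonian cycle: the entry `(i, j)` is `1` if
`i - j = ±1` modulo `n`, and `0` otherwise. -/
def cycleMat (n : ℕ) : MatSpace n :=
  WithLp.toLp 2 fun p => (SimpleGraph.cycleGraph n).adjMatrix ℝ p.1 p.2

/-- The symmetric Traveling Salesman Polytope `ST_n`: the convex hull of the `S_n`-orbit of the
adjacency matrix of a Hamiltonian cycle. -/
def symTSP (n : ℕ) : Set (MatSpace n) :=
  convexHull ℝ (Set.range fun g : Equiv.Perm (Fin n) => permAct g (cycleMat n))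

/-- The matrix `c` with `c i i = 0` and `c i j = 2 / (n - 1)` for `i ≠ j`. -/
def symTSPCenter (n : ℕ) : MatSpace n :=
  WithLp.toLp 2 fun p => if p.1 = p.2 then 0 else 2 / ((n : ℝ) - 1)

section Ellipsoids

variable {V : Type*} [NormedAddCommGroup V] [InnerProductSpace ℝ V]

/-- `E` is a (full-dimensional) ellipsoid of the affine subspace `A`: the image of the closed unit
ball of the direction of `A` under an invertible affine map onto `A`. -/
def IsEllipsoidIn (A : AffineSubspace ℝ V) (E : Set V) : Prop :=
  ∃ p ∈ A, ∃ T : A.direction ≃ₗ[ℝ] A.direction,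
    E = (fun w : A.direction => p + (T w : V)) '' Metric.closedBall 0 1

variable [MeasurableSpace V] [BorelSpace V]

/-- The volume of a subset of the affine subspace `A`, in the dimension of `A`. -/
def volIn (A : AffineSubspace ℝ V) (E : Set V) : ENNReal :=
  μHE[finrank ℝ A.direction] E

/-- Among all ellipsoids of the affine hull of `B` that are contained in `B`, the ellipsoid `E` has
the maximum volume. -/
def IsMaxVolEllipsoid (B E : Set V) : Prop :=
  IsEllipsoidIn (affineSpan ℝ B) E ∧ E ⊆ B ∧
    ∀ E' : Set V, IsEllipsoidIn (affineSpan ℝ B) E' → E' ⊆ B →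
      volIn (affineSpan ℝ B) E' ≤ volIn (affineSpan ℝ B) E

/-- Among all ellipsoids of the affine hull of `B` that contain `B`, the ellipsoid `E` has
the minimum volume. -/
def IsMinVolEllipsoid (B E : Set V) : Prop :=
  IsEllipsoidIn (affineSpan ℝ B) E ∧ B ⊆ E ∧
    ∀ E' : Set V, IsEllipsoidIn (affineSpan ℝ B) E' → B ⊆ E' →
      volIn (affineSpan ℝ B) E ≤ volIn (affineSpan ℝ B) E'

end Ellipsoids

/-- `α` is the symmetry coefficient of `B` with respect to `c`: the largest `α > 0` such that
`-α (B - c) ⊆ B - c`. -/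
def IsSymmetryCoefficient {V : Type*} [AddCommGroup V] [Module ℝ V]
    (B : Set V) (c : V) (α : ℝ) : Prop :=
  IsGreatest {t : ℝ | 0 < t ∧ ∀ x ∈ B, c - t • (x - c) ∈ B} α

/-- The closed ball of radius `r` centered at `c` in the affine hull of `B`. -/
def ballInHull {V : Type*} [NormedAddCommGroup V] [InnerProductSpace ℝ V]
    (B : Set V) (c : V) (r : ℝ) : Set V :=
  {x | x ∈ affineSpan ℝ B ∧ dist x c ≤ r}

end

/-! Let W be the direction of the affine hull: symmetric matrices with zero diagonal and zero row
sums. Both extremal ellipsoids come from a John-type argument. For vectors of equal norm with sum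
zero and ∑ ⟨y_i, x⟩² = κ‖x‖² (a tight frame), summing the containment conditions bounds the sum of
the singular values, or of their squares, of a linear map attached to the ellipsoid. The AM-GM
inequality turns this into a determinant bound whose equality case is the centered ball
(`ellipsoid_containing_tight_frame`, `ellipsoid_inside_tight_frame`).

For the outer ellipsoid the frame consists of the vertices minus c. It is tight because the sum of
the tours weighted by their entry at (i, j) is fixed by the stabilizer of i and j, hence is a
multiple of the vector `coordVec i j` representing that coordinate, with one factor κ for all edges
(`exists_tour_tight_frame`). Since κ > 0, this also shows that the tours span W.

For the inner ellipsoid the frame consists of the normals of the inequalities x_ij ≥ 0, and only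
these bound the volume. That the ball fits needs no list of facets: if f ≤ h on ST_n - c, symmetry
with coefficient α gives -αf ≤ h, and averaging (h - f)(h + αf) ≥ 0 over the vertices yields a ball
of squared radius αR²/dim W, R being the circumradius (`ball_subset_symTSP`). For α = 2/(n-3) this
radius is the distance from c to the hyperplanes x_ij = 0.

For the symmetry coefficient, reflecting a tour with factor 2/(n-3) gives 2/(n-3) times the
complementary graph, so twice the complement has to be a sum of n-3 tours
(`two_smul_complement_mem`). Label the vertices by ZMod (n-1) and ∞ and sort the edges by the sum of
their ends: the classes 2r and 2r+1 together form a tour, and an odd number of remaining classes is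
handled by the doubling. -/

/-- A normalized arithmetic-geometric mean inequality. -/
theorem prod_le_one_of_sum_le_card {ι : Type*} [Fintype ι] {x : ι → ℝ} (hx : ∀ k, 0 < x k) {δ : ℝ}
    (hδ : 0 ≤ δ) (h : ∑ k, x k ≤ Fintype.card ι - δ) : ∏ k, x k ≤ 1 := by
  have h1 : Real.log (∏ k, x k) ≤ 0 := by
    rw [Real.log_prod fun k _ => (hx k).ne']
    calc ∑ k, Real.log (x k) ≤ ∑ k, (x k - 1) :=
          Finset.sum_le_sum fun k _ => Real.log_le_sub_one_of_pos (hx k)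
      _ ≤ 0 := by simp [Finset.sum_sub_distrib]; linarith
  exact (Real.log_nonpos_iff (Finset.prod_pos fun k _ => hx k).le).1 h1

/-- The equality case of `prod_le_one_of_sum_le_card`. -/
theorem eq_one_of_sum_le_card_of_one_le_prod {ι : Type*} [Fintype ι] {x : ι → ℝ}
    (hx : ∀ k, 0 < x k) {δ : ℝ} (hδ : 0 ≤ δ) (h : ∑ k, x k ≤ Fintype.card ι - δ)
    (hp : 1 ≤ ∏ k, x k) : δ = 0 ∧ ∀ k, x k = 1 := by
  have h0 : 0 ≤ ∑ k, Real.log (x k) := by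
    rw [← Real.log_prod fun k _ => (hx k).ne']; exact Real.log_nonneg hp
  have h2 : ∑ k, (x k - 1) ≤ -δ := by simp [Finset.sum_sub_distrib]; linarith
  have h1 : ∀ k, Real.log (x k) ≤ x k - 1 := fun k => Real.log_le_sub_one_of_pos (hx k)
  have h3 := Finset.sum_le_sum fun k (_ : k ∈ Finset.univ) => h1 k
  refine ⟨by linarith, fun k => ?_⟩
  by_contra hk
  have := Finset.sum_lt_sum (fun k (_ : k ∈ Finset.univ) => h1 k)
    ⟨k, Finset.mem_univ k, Real.log_lt_sub_one_of_pos (hx k) hk⟩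
  linarith

/-! ### Volume bounds for ellipsoids around and inside tight frames. -/

section JohnEllipsoid

variable {W : Type*} [NormedAddCommGroup W] [InnerProductSpace ℝ W] [FiniteDimensional ℝ W]

theorem LinearMap.det_adjoint_real (A : W →ₗ[ℝ] W) :
    LinearMap.det (LinearMap.adjoint A) = LinearMap.det A := by
  let b := stdOrthonormalBasis ℝ W
  rw [← LinearMap.det_toMatrix b.toBasis, ← LinearMap.det_toMatrix b.toBasis A,
    LinearMap.toMatrix_adjoint b b A, Matrix.conjTranspose_eq_transpose_of_trivial,
    Matrix.det_transpose]

/-- Singular values and right singular vectors of an invertible operator. -/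
theorem exists_singular_basis (A : W →ₗ[ℝ] W) (hA : LinearMap.det A ≠ 0) :
    ∃ (b : OrthonormalBasis (Fin (finrank ℝ W)) ℝ W) (σ : Fin (finrank ℝ W) → ℝ),
      (∀ k, 0 < σ k) ∧ (∀ k, LinearMap.adjoint A (A (b k)) = σ k ^ 2 • b k) ∧
        |LinearMap.det A| = ∏ k, σ k := by
  have hS : (LinearMap.adjoint A ∘ₗ A).IsSymmetric := LinearMap.isSymmetric_adjoint_comp_self A
  have hb : ∀ k, LinearMap.adjoint A (A (hS.eigenvectorBasis rfl k)) =
      hS.eigenvalues rfl k • hS.eigenvectorBasis rfl k := fun k =>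
    hS.apply_eigenvectorBasis rfl k
  have hpos : ∀ k, 0 < hS.eigenvalues rfl k := by
    intro k
    have h1 : hS.eigenvalues rfl k = ‖A (hS.eigenvectorBasis rfl k)‖ ^ 2 := by
      rw [← real_inner_self_eq_norm_sq, ← LinearMap.adjoint_inner_left, hb, real_inner_smul_left,
        real_inner_self_eq_norm_sq]
      simp
    rw [h1]
    have h2 : A (hS.eigenvectorBasis rfl k) ≠ 0 := by
      intro h
      have := (LinearMap.equivOfDetNeZero A hA).injective
        (a₁ := hS.eigenvectorBasis rfl k) (a₂ := 0) (by simpa using h)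
      have h3 := (hS.eigenvectorBasis rfl).norm_eq_one k
      rw [this] at h3
      simp at h3
    positivity
  refine ⟨hS.eigenvectorBasis rfl, fun k => Real.sqrt (hS.eigenvalues rfl k),
    fun k => Real.sqrt_pos.2 (hpos k), fun k => ?_, ?_⟩
  · simp only [Real.sq_sqrt (hpos k).le, hb]
  · have h1 : LinearMap.det A ^ 2 = ∏ k, hS.eigenvalues rfl k := by
      have h2 := hS.det_eq_prod_eigenvalues rfl
      rw [LinearMap.det_comp, LinearMap.det_adjoint_real] at h2
      rw [sq, h2]
      rfl
    rw [← Real.sqrt_sq_eq_abs, h1, Real.sqrt_prod _ fun k _ => (hpos k).le]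

theorem norm_sq_apply_eq_sum_singular {A : W →ₗ[ℝ] W}
    {b : OrthonormalBasis (Fin (finrank ℝ W)) ℝ W} {σ : Fin (finrank ℝ W) → ℝ}
    (hb : ∀ k, LinearMap.adjoint A (A (b k)) = σ k ^ 2 • b k) (x : W) :
    ‖A x‖ ^ 2 = ∑ k, σ k ^ 2 * inner ℝ (b k) x ^ 2 := by
  have h1 : ∀ k, inner ℝ (b k) (LinearMap.adjoint A (A x)) = σ k ^ 2 * inner ℝ (b k) x := by
    intro k
    rw [LinearMap.adjoint_inner_right, ← LinearMap.adjoint_inner_left, hb, real_inner_smul_left]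
  rw [← real_inner_self_eq_norm_sq, ← LinearMap.adjoint_inner_right, ← b.sum_inner_mul_inner]
  refine Finset.sum_congr rfl fun k _ => ?_
  rw [h1, real_inner_comm x]
  ring

theorem adjoint_apply_eq_of_singular_eq {A : W →ₗ[ℝ] W}
    {b : OrthonormalBasis (Fin (finrank ℝ W)) ℝ W} {σ : Fin (finrank ℝ W) → ℝ}
    (hb : ∀ k, LinearMap.adjoint A (A (b k)) = σ k ^ 2 • b k) {r : ℝ} (h : ∀ k, σ k = r) (x : W) :
    LinearMap.adjoint A (A x) = r ^ 2 • x := by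
  have : LinearMap.adjoint A ∘ₗ A = r ^ 2 • LinearMap.id :=
    b.toBasis.ext fun k => by simp [hb, h]
  simpa using congrArg (fun f : W →ₗ[ℝ] W => f x) this

theorem norm_apply_eq_of_adjoint_apply_eq {A : W →ₗ[ℝ] W} {r : ℝ} (hr : 0 ≤ r)
    (h : ∀ x, LinearMap.adjoint A (A x) = r ^ 2 • x) (x : W) : ‖A x‖ = r * ‖x‖ := by
  rw [← sq_eq_sq₀ (norm_nonneg _) (by positivity), ← real_inner_self_eq_norm_sq,
    ← LinearMap.adjoint_inner_right, h, real_inner_smul_right, real_inner_self_eq_norm_sq]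
  ring

theorem sum_inner_sq_orthonormalBasis {W : Type*} [NormedAddCommGroup W] [InnerProductSpace ℝ W]
    {ι κ : Type*} [Fintype ι] [Fintype κ] (b : OrthonormalBasis κ ℝ W) {y : ι → W}
    {R : ℝ} (hR : ∀ i, ‖y i‖ = R) :
    ∑ k, ∑ i, inner ℝ (y i) (b k) ^ 2 = Fintype.card ι * R ^ 2 := by
  rw [Finset.sum_comm]
  have : ∀ i, ∑ k, inner ℝ (y i) (b k) ^ 2 = R ^ 2 := fun i => by
    rw [← hR i, b.sum_sq_inner_left (y i)]
  simp [this]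

variable {ι : Type*} [Fintype ι]

/-- Taking traces fixes κ. This lets the averaged bounds below be normalized to mean at most 1, as
AM-GM requires. -/
theorem tight_frame_trace {y : ι → W} {R κ : ℝ} (hR : ∀ i, ‖y i‖ = R)
    (hκ : ∀ x, ∑ i, inner ℝ (y i) x ^ 2 = κ * ‖x‖ ^ 2) :
    κ * finrank ℝ W = Fintype.card ι * R ^ 2 := by
  rw [← sum_inner_sq_orthonormalBasis (stdOrthonormalBasis ℝ W) hR]
  simp [hκ, mul_comm]

theorem sum_norm_sq_apply_tight_frame {A : W →ₗ[ℝ] W}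
    {b : OrthonormalBasis (Fin (finrank ℝ W)) ℝ W} {σ : Fin (finrank ℝ W) → ℝ}
    (hb : ∀ k, LinearMap.adjoint A (A (b k)) = σ k ^ 2 • b k) {y : ι → W} {κ : ℝ}
    (hκ : ∀ x, ∑ i, inner ℝ (y i) x ^ 2 = κ * ‖x‖ ^ 2) :
    ∑ i, ‖A (y i)‖ ^ 2 = κ * ∑ k, σ k ^ 2 := by
  simp only [norm_sq_apply_eq_sum_singular hb]
  rw [Finset.sum_comm, Finset.mul_sum]
  refine Finset.sum_congr rfl fun k _ => ?_
  have := hκ (b k)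
  simp only [b.norm_eq_one, one_pow, mul_one] at this
  rw [← Finset.mul_sum, ← this]
  simp only [real_inner_comm, mul_comm]

variable [Nonempty ι]

/-- If a centered spherical tight frame is contained in an ellipsoid, then the ellipsoid has at
least the volume of the ball through the frame, with equality only for this ball. -/
theorem ellipsoid_containing_tight_frame {y : ι → W} {R κ : ℝ} (hRpos : 0 < R)
    (hd : 0 < finrank ℝ W) (hR : ∀ i, ‖y i‖ = R) (hsum : ∑ i, y i = 0)
    (hκ : ∀ x, ∑ i, inner ℝ (y i) x ^ 2 = κ * ‖x‖ ^ 2) (T : W ≃ₗ[ℝ] W) (q : W)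
    (hT : ∀ i, ‖T.symm (y i - q)‖ ≤ 1) :
    R ^ finrank ℝ W ≤ |LinearMap.det (T : W →ₗ[ℝ] W)| ∧
      (|LinearMap.det (T : W →ₗ[ℝ] W)| ≤ R ^ finrank ℝ W → q = 0 ∧ ∀ w, ‖T w‖ = R * ‖w‖) := by
  set A : W →ₗ[ℝ] W := (T.symm : W →ₗ[ℝ] W) with hAdef
  have hdet : LinearMap.det (T : W →ₗ[ℝ] W) * LinearMap.det A = 1 := by
    exact LinearEquiv.det_mul_det_symm T
  have hdA : LinearMap.det A ≠ 0 := right_ne_zero_of_mul (hdet ▸ one_ne_zero)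
  have habs : |LinearMap.det (T : W →ₗ[ℝ] W)| * |LinearMap.det A| = 1 := by
    rw [← abs_mul, hdet, abs_one]
  obtain ⟨b, σ, hσ, hb, hprod⟩ := exists_singular_basis A hdA
  have hm : (0 : ℝ) < Fintype.card ι := by exact_mod_cast Fintype.card_pos
  have htr := tight_frame_trace hR hκ
  have hd' : (0 : ℝ) < finrank ℝ W := by exact_mod_cast hd
  -- Sum ‖A (y i - q)‖² ≤ 1 over i; the cross terms cancel because the frame is centered.
  have hbound : κ * ∑ k, σ k ^ 2 + Fintype.card ι * ‖A q‖ ^ 2 ≤ Fintype.card ι := by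
    rw [← sum_norm_sq_apply_tight_frame hb hκ]
    have h1 : ∀ i, ‖A (y i - q)‖ ^ 2 = ‖A (y i)‖ ^ 2 - 2 * inner ℝ (A (y i)) (A q) + ‖A q‖ ^ 2 := by
      intro i; rw [map_sub, norm_sub_sq_real]
    have h2 : ∑ i, ‖A (y i - q)‖ ^ 2 ≤ Fintype.card ι := by
      calc ∑ i, ‖A (y i - q)‖ ^ 2 ≤ ∑ _i : ι, (1 : ℝ) :=
            Finset.sum_le_sum fun i _ => pow_le_one₀ (norm_nonneg _) (hT i)
        _ = _ := by simp
    have h3 : ∑ i, inner ℝ (A (y i)) (A q) = 0 := by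
      rw [← sum_inner, ← map_sum, hsum, map_zero, inner_zero_left]
    simp only [h1, Finset.sum_add_distrib, Finset.sum_sub_distrib, ← Finset.mul_sum, h3] at h2
    simpa using h2
  have hκpos : 0 < κ := by
    have : 0 < κ * finrank ℝ W := by rw [htr]; positivity
    exact pos_of_mul_pos_left this hd'.le
  -- The slack δ in AM-GM is the contribution of the displaced center, so equality will force `A q =
  -- 0`.
  have hsumle : ∑ k, (R * σ k) ^ 2 ≤
      Fintype.card (Fin (finrank ℝ W)) - finrank ℝ W * ‖A q‖ ^ 2 := by
    have h1 : ∑ k, (R * σ k) ^ 2 = R ^ 2 * ∑ k, σ k ^ 2 := by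
      rw [Finset.mul_sum]; exact Finset.sum_congr rfl fun k _ => by ring
    rw [h1, Fintype.card_fin, ← mul_le_mul_iff_right₀ hm]
    have h2 : (Fintype.card ι : ℝ) * (R ^ 2 * ∑ k, σ k ^ 2) =
        finrank ℝ W * (κ * ∑ k, σ k ^ 2) := by
      rw [← mul_assoc, ← htr]; ring
    rw [h2]
    nlinarith
  have hprod2 : ∏ k, (R * σ k) ^ 2 = (R ^ finrank ℝ W * |LinearMap.det A|) ^ 2 := by
    rw [Finset.prod_pow, Finset.prod_mul_distrib, hprod]; simp
  have hpos2 : ∀ k, 0 < (R * σ k) ^ 2 := fun k => by have := hσ k; positivity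
  have hδ : 0 ≤ finrank ℝ W * ‖A q‖ ^ 2 := by positivity
  have hApos : 0 < |LinearMap.det A| := abs_pos.2 hdA
  constructor
  · have h1 := prod_le_one_of_sum_le_card hpos2 hδ hsumle
    rw [hprod2, sq_le_one_iff₀ (by positivity), ← habs] at h1
    exact le_of_mul_le_mul_right h1 hApos
  · intro hle
    have h1 : 1 ≤ ∏ k, (R * σ k) ^ 2 := by
      rw [hprod2, one_le_sq_iff₀ (by positivity), ← habs]
      exact mul_le_mul_of_nonneg_right hle hApos.le
    obtain ⟨h2, h3⟩ := eq_one_of_sum_le_card_of_one_le_prod hpos2 hδ hsumle h1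
    have hσR : ∀ k, σ k = R⁻¹ := fun k => by
      have h4 := h3 k
      have := hσ k
      rw [pow_eq_one_iff_of_nonneg (by positivity) two_ne_zero] at h4
      exact eq_inv_of_mul_eq_one_right h4
    have hAn := norm_apply_eq_of_adjoint_apply_eq (inv_pos.2 hRpos).le
      (adjoint_apply_eq_of_singular_eq hb hσR)
    constructor
    · have : ‖A q‖ = 0 := by
        rcases mul_eq_zero.1 h2 with h | h
        · exact absurd h hd'.ne'
        · exact pow_eq_zero_iff two_ne_zero |>.1 h
      rw [hAn] at this
      rcases mul_eq_zero.1 this with h | h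
      · exact absurd h (inv_pos.2 hRpos).ne'
      · exact norm_eq_zero.1 h
    · intro w
      have := hAn (T w)
      simp only [hAdef, LinearEquiv.coe_coe, LinearEquiv.symm_apply_apply] at this
      rw [this]; field_simp

/-- If an ellipsoid is contained in the polyhedron of a centered spherical tight frame, then it has
at most the volume of the inscribed ball, with equality only for this ball. -/
theorem ellipsoid_inside_tight_frame {u : ι → W} {r κ : ℝ} (hr : 0 < r)
    (hd : 0 < finrank ℝ W) (hu : ∀ i, ‖u i‖ = r⁻¹) (hsum : ∑ i, u i = 0)
    (hκ : ∀ x, ∑ i, inner ℝ (u i) x ^ 2 = κ * ‖x‖ ^ 2) (T : W ≃ₗ[ℝ] W) (q : W)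
    (hT : ∀ i, ∀ w, ‖w‖ ≤ 1 → inner ℝ (u i) (q + T w) ≤ 1) :
    |LinearMap.det (T : W →ₗ[ℝ] W)| ≤ r ^ finrank ℝ W ∧
      (r ^ finrank ℝ W ≤ |LinearMap.det (T : W →ₗ[ℝ] W)| → q = 0 ∧ ∀ w, ‖T w‖ = r * ‖w‖) := by
  set A : W →ₗ[ℝ] W := LinearMap.adjoint (T : W →ₗ[ℝ] W) with hAdef
  have hdetA : LinearMap.det A = LinearMap.det (T : W →ₗ[ℝ] W) := LinearMap.det_adjoint_real _
  have hdA : LinearMap.det A ≠ 0 := by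
    rw [hdetA]; exact (LinearEquiv.isUnit_det' T).ne_zero
  obtain ⟨b, σ, hσ, hb, hprod⟩ := exists_singular_basis A hdA
  have hm : (0 : ℝ) < Fintype.card ι := by exact_mod_cast Fintype.card_pos
  have htr := tight_frame_trace hu hκ
  have hd' : (0 : ℝ) < finrank ℝ W := by exact_mod_cast hd
  -- This is the support function of the ellipsoid, attained at the unit vector along `A (u i)`.
  have hsupp : ∀ i, inner ℝ (u i) q + ‖A (u i)‖ ≤ 1 := by
    intro i
    rcases eq_or_ne (A (u i)) 0 with h0 | h0
    · simpa [h0] using hT i 0 (by simp)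
    · have h1 := hT i (‖A (u i)‖⁻¹ • A (u i)) (by rw [norm_smul, norm_inv, norm_norm,
        inv_mul_cancel₀ (norm_ne_zero_iff.2 h0)])
      have h2 : inner ℝ (u i) (T (‖A (u i)‖⁻¹ • A (u i))) = ‖A (u i)‖ := by
        have : inner ℝ (u i) (T (A (u i))) = inner ℝ (A (u i)) (A (u i)) := by
          rw [hAdef, LinearMap.adjoint_inner_left]; rfl
        rw [map_smul, real_inner_smul_right, this, real_inner_self_eq_norm_sq, sq,
          inv_mul_cancel_left₀ (norm_ne_zero_iff.2 h0)]
      rwa [inner_add_right, h2] at h1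
  -- Cauchy–Schwarz replaces the norm by a quadratic form in `u i`; summed over the frame, this form
  -- gives κ ∑ σ k.
  have hcs : ∀ i, ∑ k, σ k * inner ℝ (u i) (b k) ^ 2 ≤ r⁻¹ * ‖A (u i)‖ := by
    intro i
    have h1 := norm_sq_apply_eq_sum_singular hb (u i)
    have h2 : ‖u i‖ ^ 2 = ∑ k, inner ℝ (u i) (b k) ^ 2 := (b.sum_sq_inner_left (u i)).symm
    refine abs_le_of_sq_le_sq' ?_ (by positivity) |>.2
    rw [mul_pow, ← hu i, h2, h1]
    refine le_trans (le_of_eq ?_) (Finset.sum_mul_sq_le_sq_mul_sq Finset.univ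
      (fun k => inner ℝ (u i) (b k)) (fun k => σ k * inner ℝ (b k) (u i))) |>.trans (le_of_eq ?_)
    · congr 1
      exact Finset.sum_congr rfl fun k _ => by rw [real_inner_comm]; ring
    · simp only [mul_pow]
  have hsumle : ∑ k, r⁻¹ * σ k ≤ Fintype.card (Fin (finrank ℝ W)) - 0 := by
    have h1 : ∑ i, ∑ k, σ k * inner ℝ (u i) (b k) ^ 2 = κ * ∑ k, σ k := by
      rw [Finset.sum_comm, Finset.mul_sum]
      refine Finset.sum_congr rfl fun k _ => ?_
      rw [← Finset.mul_sum, hκ, b.norm_eq_one]; ring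
    have h2 : ∑ i, ‖A (u i)‖ ≤ Fintype.card ι := by
      have h3 : ∑ i, (inner ℝ (u i) q + ‖A (u i)‖) ≤ ∑ _i : ι, (1 : ℝ) :=
        Finset.sum_le_sum fun i _ => hsupp i
      rw [Finset.sum_add_distrib, ← sum_inner, hsum, inner_zero_left, zero_add] at h3
      simpa using h3
    have h4 : κ * ∑ k, σ k ≤ r⁻¹ * Fintype.card ι := by
      rw [← h1]
      refine (Finset.sum_le_sum fun i _ => hcs i).trans ?_
      rw [← Finset.mul_sum]
      exact mul_le_mul_of_nonneg_left h2 (by positivity)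
    rw [← Finset.mul_sum, Fintype.card_fin, sub_zero, ← mul_le_mul_iff_right₀ hm]
    have h5 : (Fintype.card ι : ℝ) * (r⁻¹ * ∑ k, σ k) =
        r * finrank ℝ W * (κ * ∑ k, σ k) := by
      have : (Fintype.card ι : ℝ) * r⁻¹ = r * (κ * finrank ℝ W) := by
        rw [htr]; field_simp
      rw [← mul_assoc, this]; ring
    rw [h5]
    refine (mul_le_mul_of_nonneg_left h4 (by positivity)).trans (le_of_eq ?_)
    field_simp
  have hprod2 : ∏ k, r⁻¹ * σ k = (r ^ finrank ℝ W)⁻¹ * |LinearMap.det (T : W →ₗ[ℝ] W)| := by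
    rw [Finset.prod_mul_distrib, ← hprod, hdetA]; simp
  have hpos2 : ∀ k, 0 < r⁻¹ * σ k := fun k => by have := hσ k; positivity
  have hrd : 0 < r ^ finrank ℝ W := by positivity
  constructor
  · have h1 := prod_le_one_of_sum_le_card hpos2 le_rfl hsumle
    rwa [hprod2, inv_mul_le_one₀ hrd] at h1
  · intro hle
    have h1 : 1 ≤ ∏ k, r⁻¹ * σ k := by
      rw [hprod2, inv_mul_eq_div, one_le_div hrd]; exact hle
    have h3 := (eq_one_of_sum_le_card_of_one_le_prod hpos2 le_rfl hsumle h1).2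
    have hσr : ∀ k, σ k = r := fun k => by
      have h4 := h3 k
      rwa [inv_mul_eq_one₀ hr.ne', eq_comm] at h4
    have hAA := adjoint_apply_eq_of_singular_eq hb hσr
    have hAn := norm_apply_eq_of_adjoint_apply_eq hr.le hAA
    constructor
    -- These nonpositive numbers sum to zero, so all vanish, and the frame identity at q gives q =
    -- 0.
    · have h5 : ∀ i, inner ℝ (u i) q ≤ 0 := fun i => by
        have := hsupp i
        rw [hAn, hu, mul_inv_cancel₀ hr.ne'] at this
        linarith
      have h6 : ∑ i, inner ℝ (u i) q = 0 := by rw [← sum_inner, hsum, inner_zero_left]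
      have h7 := (Finset.sum_eq_zero_iff_of_nonpos fun i _ => h5 i).1 h6
      have h8 := hκ q
      rw [Finset.sum_eq_zero fun i hi => by rw [h7 i hi]; simp] at h8
      have hκpos : 0 < κ := by
        have : 0 < κ * finrank ℝ W := by rw [htr]; positivity
        exact pos_of_mul_pos_left this hd'.le
      have h9 : ‖q‖ ^ 2 = 0 := by
        rcases mul_eq_zero.1 h8.symm with h | h
        · exact absurd h hκpos.ne'
        · exact h
      exact norm_eq_zero.1 (pow_eq_zero_iff two_ne_zero |>.1 h9)
    -- The singular values give T T* = r²; the norm of `T w` needs T* T = r², which follows since a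
    -- one-sided inverse is two-sided.
    · have hTA : (T : W →ₗ[ℝ] W) ∘ₗ A = r ^ 2 • LinearMap.id := by
        ext x
        have := hAA x
        rw [hAdef, LinearMap.adjoint_adjoint] at this
        simpa [hAdef] using this
      have hAT : ∀ x, A (T x) = r ^ 2 • x := by
        intro x
        have h1 : ((r ^ 2)⁻¹ • (T : W →ₗ[ℝ] W)) * A = 1 := by
          ext x
          have := congrArg (fun f : W →ₗ[ℝ] W => f x) hTA
          simp only [LinearMap.comp_apply] at this
          simp only [Module.End.mul_apply, LinearMap.smul_apply, this]
          simp [smul_smul, hr.ne']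
        have h2 := congrArg (fun f : W →ₗ[ℝ] W => f x) (mul_eq_one_comm.1 h1)
        simp only [Module.End.mul_apply, LinearMap.smul_apply, map_smul, Module.End.one_apply] at h2
        rw [← h2, smul_smul, mul_inv_cancel₀ (by positivity), one_smul, h2]
        rfl
      exact norm_apply_eq_of_adjoint_apply_eq hr.le hAT

end JohnEllipsoid

/-! ### From determinants to volumes in the affine hull. -/

section Volume

variable {V : Type*} [NormedAddCommGroup V] [InnerProductSpace ℝ V] [FiniteDimensional ℝ V]
  [MeasurableSpace V] [BorelSpace V]

/-- The map w ↦ p + w is an isometry from the direction, so the Hausdorff measure becomes Lebesgue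
measure there. -/
theorem volIn_ellipsoid (A : AffineSubspace ℝ V) (p : V) (T : A.direction ≃ₗ[ℝ] A.direction) :
    volIn A ((fun w : A.direction => p + (T w : V)) '' Metric.closedBall 0 1) =
      ENNReal.ofReal |LinearMap.det (T : A.direction →ₗ[ℝ] A.direction)| *
        volume (Metric.closedBall (0 : A.direction) 1) := by
  have hiso : Isometry (fun w : A.direction => p + (w : V)) :=
    (IsometryEquiv.addLeft p).isometry.comp isometry_subtype_coe
  have h : (fun w : A.direction => p + (T w : V)) '' Metric.closedBall 0 1 =
      (fun w : A.direction => p + (w : V)) ''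
        ((T : A.direction →ₗ[ℝ] A.direction) '' Metric.closedBall 0 1) := by
    rw [Set.image_image]; rfl
  rw [h, volIn, hiso.euclideanHausdorffMeasure_image,
    InnerProductSpace.euclideanHausdorffMeasure_eq_volume, Measure.addHaar_image_linearMap]

theorem volIn_ellipsoid_le_iff (A : AffineSubspace ℝ V) (p p' : V)
    (T T' : A.direction ≃ₗ[ℝ] A.direction) :
    volIn A ((fun w : A.direction => p + (T w : V)) '' Metric.closedBall 0 1) ≤
        volIn A ((fun w : A.direction => p' + (T' w : V)) '' Metric.closedBall 0 1) ↔
      |LinearMap.det (T : A.direction →ₗ[ℝ] A.direction)| ≤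
        |LinearMap.det (T' : A.direction →ₗ[ℝ] A.direction)| := by
  rw [volIn_ellipsoid, volIn_ellipsoid, ENNReal.mul_le_mul_iff_left
    (Metric.measure_closedBall_pos volume _ one_pos).ne' measure_closedBall_lt_top.ne,
    ENNReal.ofReal_le_ofReal_iff (abs_nonneg _)]

/-- The equality cases determine T only up to an orthogonal factor, which does not change the image
of the ball. -/
theorem image_closedBall_eq_ballInHull {V : Type*} [NormedAddCommGroup V] [InnerProductSpace ℝ V]
    {B : Set V} {c p : V} (hp : p ∈ affineSpan ℝ B)
    (T : (affineSpan ℝ B).direction ≃ₗ[ℝ] (affineSpan ℝ B).direction) {r : ℝ} (hr : 0 < r)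
    (hpc : p = c) (hT : ∀ w, ‖T w‖ = r * ‖w‖) :
    (fun w : (affineSpan ℝ B).direction => p + (T w : V)) '' Metric.closedBall 0 1 =
      ballInHull B c r := by
  subst hpc
  ext x
  simp only [Set.mem_image, Metric.mem_closedBall, dist_zero_right, ballInHull, Set.mem_ofPred_eq]
  constructor
  · rintro ⟨w, hw, rfl⟩
    refine ⟨?_, ?_⟩
    · rw [add_comm]; exact AffineSubspace.vadd_mem_of_mem_direction (T w).2 hp
    · rw [dist_eq_norm, add_sub_cancel_left, ← Submodule.coe_norm, hT]
      exact mul_le_of_le_one_right hr.le hw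
  · rintro ⟨hx, hd⟩
    refine ⟨T.symm ⟨x - p, AffineSubspace.vsub_mem_direction hx hp⟩, ?_, by simp⟩
    have := hT (T.symm ⟨x - p, AffineSubspace.vsub_mem_direction hx hp⟩)
    rw [LinearEquiv.apply_symm_apply, Submodule.coe_norm, Subtype.coe_mk, ← dist_eq_norm] at this
    rw [this] at hd
    exact le_of_mul_le_mul_left (by simpa using hd) hr

/-- A positive multiple of the identity as a linear equivalence. -/
noncomputable def scaleEquiv (W : Type*) [AddCommGroup W] [Module ℝ W]
    {r : ℝ} (hr : 0 < r) : W ≃ₗ[ℝ] W :=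
  LinearEquiv.smulOfNeZero ℝ W r hr.ne'

theorem norm_scaleEquiv {W : Type*} [NormedAddCommGroup W] [NormedSpace ℝ W] {r : ℝ} (hr : 0 < r)
    (w : W) : ‖scaleEquiv W hr w‖ = r * ‖w‖ := by
  simp [scaleEquiv, norm_smul, abs_of_pos hr]

theorem abs_det_scaleEquiv {W : Type*} [AddCommGroup W] [Module ℝ W]
    {r : ℝ} (hr : 0 < r) :
    |LinearMap.det (scaleEquiv W hr : W →ₗ[ℝ] W)| = r ^ finrank ℝ W := by
  have : (scaleEquiv W hr : W →ₗ[ℝ] W) = r • LinearMap.id := by ext; simp [scaleEquiv]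
  rw [this, LinearMap.det_smul]
  simp [abs_of_pos hr]

theorem ballInHull_eq_image {V : Type*} [NormedAddCommGroup V] [InnerProductSpace ℝ V]
    {B : Set V} {c : V} (hc : c ∈ affineSpan ℝ B) {r : ℝ} (hr : 0 < r) :
    ballInHull B c r = (fun w : (affineSpan ℝ B).direction =>
      c + (scaleEquiv (affineSpan ℝ B).direction hr w : V)) '' Metric.closedBall 0 1 :=
  (image_closedBall_eq_ballInHull hc _ hr rfl (norm_scaleEquiv hr)).symm

/-- A ball whose volume is minimal among the ellipsoids containing `B`, with a rigid equality case,
is the unique minimum volume ellipsoid. -/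
theorem isMinVolEllipsoid_iff_ball {B : Set V} {c : V} (hc : c ∈ affineSpan ℝ B) {r : ℝ}
    (hr : 0 < r) (hB : B ⊆ ballInHull B c r)
    (h : ∀ p ∈ affineSpan ℝ B,
      ∀ T : (affineSpan ℝ B).direction ≃ₗ[ℝ] (affineSpan ℝ B).direction,
      B ⊆ (fun w : (affineSpan ℝ B).direction => p + (T w : V)) '' Metric.closedBall 0 1 →
      r ^ finrank ℝ (affineSpan ℝ B).direction ≤ |LinearMap.det
          (T : (affineSpan ℝ B).direction →ₗ[ℝ] (affineSpan ℝ B).direction)| ∧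
        (|LinearMap.det (T : (affineSpan ℝ B).direction →ₗ[ℝ] (affineSpan ℝ B).direction)| ≤
          r ^ finrank ℝ (affineSpan ℝ B).direction → p = c ∧ ∀ w, ‖T w‖ = r * ‖w‖))
    (E : Set V) : IsMinVolEllipsoid B E ↔ E = ballInHull B c r := by
  have hball : IsEllipsoidIn (affineSpan ℝ B) (ballInHull B c r) :=
    ⟨c, hc, _, ballInHull_eq_image hc hr⟩
  constructor
  · rintro ⟨⟨p, hp, T, rfl⟩, hE, hmin⟩
    have hle := hmin _ hball hB
    rw [ballInHull_eq_image hc hr, volIn_ellipsoid_le_iff, abs_det_scaleEquiv] at hle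
    obtain ⟨h1, h2⟩ := (h p hp T hE).2 hle
    exact image_closedBall_eq_ballInHull hp T hr h1 h2
  · rintro rfl
    refine ⟨hball, hB, ?_⟩
    rintro _ ⟨p, hp, T, rfl⟩ hE
    rw [ballInHull_eq_image hc hr, volIn_ellipsoid_le_iff, abs_det_scaleEquiv]
    exact (h p hp T hE).1

/-- A ball whose volume is maximal among the ellipsoids contained in `B`, with a rigid equality
case, is the unique maximum volume ellipsoid. -/
theorem isMaxVolEllipsoid_iff_ball {B : Set V} {c : V} (hc : c ∈ affineSpan ℝ B) {r : ℝ}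
    (hr : 0 < r) (hB : ballInHull B c r ⊆ B)
    (h : ∀ p ∈ affineSpan ℝ B,
      ∀ T : (affineSpan ℝ B).direction ≃ₗ[ℝ] (affineSpan ℝ B).direction,
      (fun w : (affineSpan ℝ B).direction => p + (T w : V)) '' Metric.closedBall 0 1 ⊆ B →
      |LinearMap.det (T : (affineSpan ℝ B).direction →ₗ[ℝ] (affineSpan ℝ B).direction)| ≤
          r ^ finrank ℝ (affineSpan ℝ B).direction ∧
        (r ^ finrank ℝ (affineSpan ℝ B).direction ≤ |LinearMap.det
            (T : (affineSpan ℝ B).direction →ₗ[ℝ] (affineSpan ℝ B).direction)| →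
          p = c ∧ ∀ w, ‖T w‖ = r * ‖w‖))
    (E : Set V) : IsMaxVolEllipsoid B E ↔ E = ballInHull B c r := by
  have hball : IsEllipsoidIn (affineSpan ℝ B) (ballInHull B c r) :=
    ⟨c, hc, _, ballInHull_eq_image hc hr⟩
  constructor
  · rintro ⟨⟨p, hp, T, rfl⟩, hE, hmax⟩
    have hle := hmax _ hball hB
    rw [ballInHull_eq_image hc hr, volIn_ellipsoid_le_iff, abs_det_scaleEquiv] at hle
    obtain ⟨h1, h2⟩ := (h p hp T hE).2 hle
    exact image_closedBall_eq_ballInHull hp T hr h1 h2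
  · rintro rfl
    refine ⟨hball, hB, ?_⟩
    rintro _ ⟨p, hp, T, rfl⟩ hE
    rw [ballInHull_eq_image hc hr, volIn_ellipsoid_le_iff, abs_det_scaleEquiv]
    exact (h p hp T hE).1

end Volume

/-! ### The direction space and its coordinate functionals. -/

section TSP

variable {n : ℕ}

theorem MatSpace.inner_eq (x y : MatSpace n) :
    inner ℝ x y = ∑ i, ∑ j, x (i, j) * y (i, j) := by
  rw [PiLp.inner_apply, Fintype.sum_prod_type]
  simp [mul_comm]

theorem MatSpace.norm_sq_eq (x : MatSpace n) : ‖x‖ ^ 2 = ∑ i, ∑ j, x (i, j) ^ 2 := by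
  rw [← real_inner_self_eq_norm_sq, MatSpace.inner_eq]
  simp only [sq]

/-- The symmetric matrices with zero diagonal and zero row sums. -/
def tspDirection (n : ℕ) : Submodule ℝ (MatSpace n) where
  carrier := {x | (∀ i j, x (i, j) = x (j, i)) ∧ (∀ i, x (i, i) = 0) ∧ ∀ i, ∑ j, x (i, j) = 0}
  zero_mem' := by simp
  add_mem' := by
    rintro x y ⟨h1, h2, h3⟩ ⟨h4, h5, h6⟩
    refine ⟨fun i j => ?_, fun i => ?_, fun i => ?_⟩
    · simp [h1 i j, h4 i j]
    · simp [h2, h5]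
    · simp [Finset.sum_add_distrib, h3, h6]
  smul_mem' := by
    rintro a x ⟨h1, h2, h3⟩
    refine ⟨fun i j => ?_, fun i => ?_, fun i => ?_⟩
    · simp [h1 i j]
    · simp [h2]
    · simp [← Finset.mul_sum, h3]

theorem mem_tspDirection {x : MatSpace n} : x ∈ tspDirection n ↔
    (∀ i j, x (i, j) = x (j, i)) ∧ (∀ i, x (i, i) = 0) ∧ ∀ i, ∑ j, x (i, j) = 0 := Iff.rfl

theorem colSum_eq_zero {x : MatSpace n} (hx : x ∈ tspDirection n) (j : Fin n) :
    ∑ i, x (i, j) = 0 := by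
  rw [← hx.2.2 j]; exact Finset.sum_congr rfl fun i _ => hx.1 i j

/-- The vector of `tspDirection n` that represents the coordinate functional `x ↦ x (i, j)`. -/
noncomputable def coordVec (i j : Fin n) : MatSpace n :=
  WithLp.toLp 2 fun p =>
    (1 - if p.1 = p.2 then 1 else 0) * (1 / (((n : ℝ) - 1) * (n - 2)) - 1 / (2 * ((n : ℝ) - 2)) *
      ((if p.1 = i then 1 else 0) + (if p.1 = j then 1 else 0) + (if p.2 = i then 1 else 0) +
        (if p.2 = j then 1 else 0))) +
    1 / 2 * ((if p.1 = i then 1 else 0) * (if p.2 = j then 1 else 0) +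
      (if p.1 = j then 1 else 0) * (if p.2 = i then 1 else 0))

theorem coordVec_apply (i j k l : Fin n) : coordVec i j (k, l) =
    (1 - if k = l then 1 else 0) * (1 / (((n : ℝ) - 1) * (n - 2)) - 1 / (2 * ((n : ℝ) - 2)) *
      ((if k = i then 1 else 0) + (if k = j then 1 else 0) + (if l = i then 1 else 0) +
        (if l = j then 1 else 0))) +
    1 / 2 * ((if k = i then 1 else 0) * (if l = j then 1 else 0) +
      (if k = j then 1 else 0) * (if l = i then 1 else 0)) := rfl

/-- `coordVec i j` is the projection of (E_ij + E_ji)/2 onto W. The correction is a constant plus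
row and column indicators off the diagonal, hence orthogonal to W; its coefficients are those that
make the row sums vanish. -/
theorem coordVec_mem (hn : 4 ≤ n) {i j : Fin n} (hij : i ≠ j) : coordVec i j ∈ tspDirection n := by
  have hn' : (4 : ℝ) ≤ n := by exact_mod_cast hn
  have h1 : (n : ℝ) - 1 ≠ 0 := by linarith
  have h2 : (n : ℝ) - 2 ≠ 0 := by linarith
  refine ⟨fun k l => ?_, fun k => ?_, fun k => ?_⟩
  · simp only [coordVec_apply, eq_comm (a := k) (b := l)]
    ring
  · rw [coordVec_apply]
    by_cases h : k = i
    · subst h; simp [hij]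
    · simp [h]
  · simp only [coordVec_apply, sub_mul, one_mul, Finset.sum_add_distrib, Finset.sum_sub_distrib,
      mul_add, ite_mul, zero_mul, Finset.sum_ite_eq, Finset.sum_ite_eq',
      Finset.mem_univ, if_true, Finset.sum_const, Finset.card_univ, Fintype.card_fin, nsmul_eq_mul,
      mul_ite, mul_zero, mul_one]
    by_cases h : k = i
    · subst h; simp only [hij, if_true, if_false]; field_simp; ring
    · by_cases h' : k = j
      · subst h'; simp only [h, if_true, if_false]; field_simp; ring
      · simp only [h, h', if_false]; field_simp; ring

theorem inner_coordVec (i j : Fin n) {x : MatSpace n}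
    (hx : x ∈ tspDirection n) : inner ℝ (coordVec i j) x = x (i, j) := by
  have h : ∀ k l, coordVec i j (k, l) * x (k, l) = (1 / (((n : ℝ) - 1) * (n - 2))) * x (k, l) -
      1 / (2 * ((n : ℝ) - 2)) * ((if k = i then 1 else 0) * x (k, l)
        + (if k = j then 1 else 0) * x (k, l) + (if l = i then 1 else 0) * x (k, l)
        + (if l = j then 1 else 0) * x (k, l)) +
      1 / 2 * ((if k = i then 1 else 0) * ((if l = j then 1 else 0) * x (k, l)) +
        (if k = j then 1 else 0) * ((if l = i then 1 else 0) * x (k, l))) := by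
    intro k l
    rw [coordVec_apply]
    by_cases hkl : k = l
    · subst hkl; rw [hx.2.1]; ring
    · simp only [hkl, if_false]; ring
  rw [MatSpace.inner_eq]
  simp only [h, Finset.sum_add_distrib, Finset.sum_sub_distrib, ← Finset.mul_sum, hx.2.2]
  have h1 : ∀ i, ∑ k, ∑ l, (if l = i then 1 else 0) * x (k, l) = 0 := fun i => by
    simpa using colSum_eq_zero hx i
  simp only [h1, mul_zero, Finset.sum_const_zero]
  simp only [ite_mul, zero_mul, one_mul, Finset.sum_ite_eq', Finset.mem_univ, if_true]
  rw [hx.1 j i]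
  ring

theorem coordVec_apply_self (hn : 4 ≤ n) {i j : Fin n} (hij : i ≠ j) :
    coordVec i j (i, j) = ((n : ℝ) - 3) / (2 * (n - 1)) := by
  have hn' : (4 : ℝ) ≤ n := by exact_mod_cast hn
  have h1 : (n : ℝ) - 1 ≠ 0 := by linarith
  have h2 : (n : ℝ) - 2 ≠ 0 := by linarith
  rw [coordVec_apply]
  simp only [hij, hij.symm, if_true, if_false]
  field_simp
  ring

theorem norm_sq_coordVec (hn : 4 ≤ n) {i j : Fin n} (hij : i ≠ j) :
    ‖coordVec i j‖ ^ 2 = ((n : ℝ) - 3) / (2 * (n - 1)) := by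
  rw [← real_inner_self_eq_norm_sq, inner_coordVec i j (coordVec_mem hn hij),
    coordVec_apply_self hn hij]

/-- The dimension is the trace of the projection onto W: it equals ∑ ‖`coordVec i j`‖² over the
n(n-1) ordered pairs i ≠ j. -/
theorem finrank_tspDirection (hn : 4 ≤ n) :
    (finrank ℝ (tspDirection n) : ℝ) = ((n : ℝ) ^ 2 - 3 * n) / 2 := by
  have hn' : (4 : ℝ) ≤ n := by exact_mod_cast hn
  let b := stdOrthonormalBasis ℝ (tspDirection n)
  have h1 : ∑ k, ‖(b k : MatSpace n)‖ ^ 2 = finrank ℝ (tspDirection n) := by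
    have : ∀ k, ‖(b k : MatSpace n)‖ = 1 := fun k => b.norm_eq_one k
    simp [this]
  rw [← h1]
  simp only [MatSpace.norm_sq_eq]
  rw [Finset.sum_comm]
  have h2 : ∀ i j : Fin n, ∑ k, (b k : MatSpace n) (i, j) ^ 2 =
      (1 - if i = j then 1 else 0) * (((n : ℝ) - 3) / (2 * (n - 1))) := by
    intro i j
    by_cases hij : i = j
    · subst hij
      simp [(b _).2.2.1]
    · rw [if_neg hij, ← norm_sq_coordVec hn hij]
      have h3 := b.sum_sq_inner_left ⟨coordVec i j, coordVec_mem hn hij⟩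
      simp only [Submodule.coe_inner, inner_coordVec i j (b _).2, Submodule.coe_norm] at h3
      rw [h3]; ring
  have h3 : ∀ i : Fin n, ∑ k, ∑ j, (b k : MatSpace n) (i, j) ^ 2 =
      ((n : ℝ) - 1) * (((n : ℝ) - 3) / (2 * (n - 1))) := by
    intro i
    rw [Finset.sum_comm]
    simp [h2, ← Finset.sum_mul, Finset.sum_sub_distrib]
  simp only [h3, Finset.sum_const, Finset.card_univ, Fintype.card_fin, nsmul_eq_mul]
  have : (n : ℝ) - 1 ≠ 0 := by linarith
  field_simp

/-! ### The action of the symmetric group -/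

theorem permAct_apply (g : Equiv.Perm (Fin n)) (a : MatSpace n) (i j : Fin n) :
    permAct g a (i, j) = a (g⁻¹ i, g⁻¹ j) := rfl

theorem permAct_apply_apply (g : Equiv.Perm (Fin n)) (a : MatSpace n) (i j : Fin n) :
    permAct g a (g i, g j) = a (i, j) := by simp [permAct_apply]

theorem permAct_one (a : MatSpace n) : permAct 1 a = a := by
  rfl

theorem permAct_mul (g h : Equiv.Perm (Fin n)) (a : MatSpace n) :
    permAct (g * h) a = permAct g (permAct h a) := by
  rfl

theorem permAct_sub (g : Equiv.Perm (Fin n)) (a b : MatSpace n) :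
    permAct g (a - b) = permAct g a - permAct g b := by
  ext ⟨i, j⟩; simp [permAct_apply]

theorem permAct_smul (g : Equiv.Perm (Fin n)) (t : ℝ) (a : MatSpace n) :
    permAct g (t • a) = t • permAct g a := by
  ext ⟨i, j⟩; simp [permAct_apply]

theorem permAct_sum {ι : Type*} (s : Finset ι) (g : Equiv.Perm (Fin n)) (a : ι → MatSpace n) :
    permAct g (∑ k ∈ s, a k) = ∑ k ∈ s, permAct g (a k) := by
  ext ⟨i, j⟩; simp [permAct_apply]

theorem norm_permAct (g : Equiv.Perm (Fin n)) (a : MatSpace n) : ‖permAct g a‖ = ‖a‖ := by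
  rw [← sq_eq_sq₀ (norm_nonneg _) (norm_nonneg _), MatSpace.norm_sq_eq, MatSpace.norm_sq_eq,
    ← Equiv.sum_comp g]
  refine Finset.sum_congr rfl fun i _ => ?_
  rw [← Equiv.sum_comp g]
  simp only [permAct_apply_apply]

theorem permAct_mem {x : MatSpace n} (hx : x ∈ tspDirection n) (g : Equiv.Perm (Fin n)) :
    permAct g x ∈ tspDirection n := by
  refine ⟨fun i j => hx.1 _ _, fun i => hx.2.1 _, fun i => ?_⟩
  simp only [permAct_apply]
  rw [Equiv.sum_comp g⁻¹ fun j => x (g⁻¹ i, j)]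
  exact hx.2.2 _

theorem symTSPCenter_apply (i j : Fin n) :
    symTSPCenter n (i, j) = if i = j then 0 else 2 / ((n : ℝ) - 1) := rfl

theorem permAct_center (g : Equiv.Perm (Fin n)) :
    permAct g (symTSPCenter n) = symTSPCenter n := by
  ext ⟨i, j⟩; simp [permAct_apply, symTSPCenter_apply]

theorem exists_perm_apply_eq {i j i' j' : Fin n} (h : i ≠ j) (h' : i' ≠ j') :
    ∃ g : Equiv.Perm (Fin n), g i = i' ∧ g j = j' := by
  have h1 : Equiv.swap i i' j ≠ i' := fun h2 => h (by
    exact ((Equiv.swap i i').injective (h2.trans (Equiv.swap_apply_left i i').symm)).symm)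
  refine ⟨Equiv.swap (Equiv.swap i i' j) j' * Equiv.swap i i', ?_, by simp⟩
  rw [Equiv.Perm.mul_apply, Equiv.swap_apply_left, Equiv.swap_apply_of_ne_of_ne h1.symm h']

/-- The stabilizer of an edge has no nonzero fixed vector that vanishes at this edge. -/
theorem eq_zero_of_swap_invariant (hn : 4 ≤ n) {i j : Fin n} (hij : i ≠ j) {z : MatSpace n}
    (hz : z ∈ tspDirection n) (h0 : z (i, j) = 0)
    (hinv : ∀ k l, k ≠ i → k ≠ j → l ≠ i → l ≠ j → permAct (Equiv.swap k l) z = z) : z = 0 := by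
  have hn' : (4 : ℝ) ≤ n := by exact_mod_cast hn
  -- Invariance under swaps makes each row constant off the diagonal and off the columns i, j.
  have hmove : ∀ a k l, a ≠ k → a ≠ l → k ≠ i → k ≠ j → l ≠ i → l ≠ j → z (a, k) = z (a, l) := by
    intro a k l hak hal hki hkj hli hlj
    conv_lhs => rw [← hinv k l hki hkj hli hlj]
    rw [permAct_apply, Equiv.swap_inv, Equiv.swap_apply_of_ne_of_ne hak hal, Equiv.swap_apply_left]
  -- Stated for (i', j') to serve both (i, j) and (j, i). Such a row has n-2 equal entries and zeros
  -- elsewhere, so its zero sum kills them.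
  have hrow : ∀ i' j', i' ≠ j' → (∀ k, (k ≠ i ∧ k ≠ j) ↔ (k ≠ i' ∧ k ≠ j')) → z (i', j') = 0 →
      ∀ k, k ≠ i → k ≠ j → z (i', k) = 0 := by
    intro i' j' hij' hiff h0' k hki hkj
    have hk := (hiff k).1 ⟨hki, hkj⟩
    have h1 : ∀ l, z (i', l) =
        (1 - (if l = i' then 1 else 0) - (if l = j' then 1 else 0)) * z (i', k) := by
      intro l
      by_cases hl : l = i'
      · subst hl; simp [hij', hz.2.1]
      · by_cases hl' : l = j'
        · subst hl'; simp [hl, h0']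
        · have := (hiff l).2 ⟨hl, hl'⟩
          simp only [hl, hl', if_false, sub_zero, one_mul]
          exact hmove _ _ _ (Ne.symm hl) hk.1.symm this.1 this.2 hki hkj
    have h2 := hz.2.2 i'
    rw [Finset.sum_congr rfl fun l _ => h1 l, ← Finset.sum_mul] at h2
    simp only [Finset.sum_sub_distrib, Finset.sum_ite_eq', Finset.mem_univ, if_true,
      Finset.sum_const, Finset.card_univ, Fintype.card_fin, nsmul_eq_mul, mul_one] at h2
    exact (mul_eq_zero.1 h2).resolve_left (by linarith)
  have hi := hrow i j hij (fun _ => Iff.rfl) h0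
  have hj := hrow j i hij.symm (fun _ => and_comm) (by rw [hz.1, h0])
  -- Here n-3 equal entries remain in row k, and n-3 ≠ 0.
  have hkl : ∀ k l, k ≠ i → k ≠ j → l ≠ i → l ≠ j → k ≠ l → z (k, l) = 0 := by
    intro k l hki hkj hli hlj hkl
    have h1 : ∀ m, z (k, m) = (1 - (if m = i then 1 else 0) - (if m = j then 1 else 0) -
        (if m = k then 1 else 0)) * z (k, l) := by
      intro m
      by_cases hmi : m = i
      · subst hmi; simp [hij, hki.symm, hz.1 k, hi k hki hkj]
      · by_cases hmj : m = j
        · subst hmj; simp [hmi, hkj.symm, hz.1 k, hj k hki hkj]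
        · by_cases hmk : m = k
          · subst hmk; simp [hmi, hmj, hz.2.1]
          · simp only [hmi, hmj, hmk, if_false, sub_zero, one_mul]
            exact hmove _ _ _ (Ne.symm hmk) hkl hmi hmj hli hlj
    have h2 := hz.2.2 k
    rw [Finset.sum_congr rfl fun l _ => h1 l, ← Finset.sum_mul] at h2
    simp only [Finset.sum_sub_distrib, Finset.sum_ite_eq', Finset.mem_univ, if_true,
      Finset.sum_const, Finset.card_univ, Fintype.card_fin, nsmul_eq_mul, mul_one] at h2
    exact (mul_eq_zero.1 h2).resolve_left (by linarith)
  ext ⟨k, l⟩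
  show z (k, l) = 0
  by_cases hkl' : k = l
  · subst hkl'; exact hz.2.1 k
  by_cases hki : k = i
  · subst hki
    by_cases hlj : l = j
    · subst hlj; exact h0
    · exact hi l (Ne.symm hkl') hlj
  by_cases hkj : k = j
  · subst hkj
    by_cases hli : l = i
    · subst hli; rw [hz.1, h0]
    · exact hj l hli (Ne.symm hkl')
  by_cases hli : l = i
  · subst hli; rw [hz.1]; exact hi k hki hkj
  by_cases hlj : l = j
  · subst hlj; rw [hz.1]; exact hj k hki hkj
  exact hkl k l hki hkj hli hlj hkl'

theorem permAct_coordVec_of_fix {i j : Fin n} (g : Equiv.Perm (Fin n)) (hi : g i = i)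
    (hj : g j = j) : permAct g (coordVec i j) = coordVec i j := by
  have h1 : ∀ k, g⁻¹ k = i ↔ k = i := fun k => by rw [Equiv.Perm.inv_eq_iff_eq, hi, eq_comm]
  have h2 : ∀ k, g⁻¹ k = j ↔ k = j := fun k => by rw [Equiv.Perm.inv_eq_iff_eq, hj, eq_comm]
  ext ⟨k, l⟩
  simp only [permAct_apply, coordVec_apply, h1, h2, g⁻¹.injective.eq_iff]

/-- The factor is chosen so that the difference vanishes at (i, j); invariance under the stabilizer
then makes it zero. -/
theorem eq_smul_coordVec (hn : 4 ≤ n) {i j : Fin n} (hij : i ≠ j) {z : MatSpace n}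
    (hz : z ∈ tspDirection n)
    (hinv : ∀ g : Equiv.Perm (Fin n), g i = i → g j = j → permAct g z = z) :
    z = (z (i, j) / (((n : ℝ) - 3) / (2 * (n - 1)))) • coordVec i j := by
  have hn' : (4 : ℝ) ≤ n := by exact_mod_cast hn
  have h1 : (n : ℝ) - 1 ≠ 0 := by linarith
  have h3 : (n : ℝ) - 3 ≠ 0 := by linarith
  rw [← sub_eq_zero]
  refine eq_zero_of_swap_invariant hn hij
    (Submodule.sub_mem _ hz (Submodule.smul_mem _ _ (coordVec_mem hn hij))) ?_ ?_
  · simp only [PiLp.sub_apply, PiLp.smul_apply, smul_eq_mul, coordVec_apply_self hn hij]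
    field_simp
    ring
  · intro k l hki hkj hli hlj
    have hi : Equiv.swap k l i = i := Equiv.swap_apply_of_ne_of_ne hki.symm hli.symm
    have hj : Equiv.swap k l j = j := Equiv.swap_apply_of_ne_of_ne hkj.symm hlj.symm
    rw [permAct_sub, permAct_smul, hinv _ hi hj, permAct_coordVec_of_fix _ hi hj]

end TSP

/-! ### The vertices form a centered tight frame. -/

section TSP

variable {n : ℕ}

theorem cycleMat_symm (i j : Fin n) : cycleMat n (i, j) = cycleMat n (j, i) := by
  simp [cycleMat, SimpleGraph.adjMatrix_apply, SimpleGraph.adj_comm]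

theorem cycleMat_diag (i : Fin n) : cycleMat n (i, i) = 0 := by
  simp [cycleMat, SimpleGraph.adjMatrix_apply]

theorem cycleMat_eq_zero_or_one (i j : Fin n) : cycleMat n (i, j) = 0 ∨ cycleMat n (i, j) = 1 := by
  by_cases h : (SimpleGraph.cycleGraph n).Adj i j <;>
    simp [cycleMat, SimpleGraph.adjMatrix_apply, h]

theorem cycleMat_nonneg (i j : Fin n) : 0 ≤ cycleMat n (i, j) := by
  rcases cycleMat_eq_zero_or_one i j with h | h <;> simp [h]

theorem cycleMat_rowSum (hn : 3 ≤ n) (i : Fin n) : ∑ j, cycleMat n (i, j) = 2 := by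
  obtain ⟨m, rfl⟩ := Nat.exists_eq_add_of_le' hn
  have h := SimpleGraph.adjMatrix_mulVec_const_apply
    (G := SimpleGraph.cycleGraph (m + 3)) (a := (1 : ℝ)) (v := i)
  rw [SimpleGraph.cycleGraph_degree_three_le] at h
  simpa [Matrix.mulVec, dotProduct, cycleMat] using h

/-- The vertex `permAct g (cycleMat n)` of the polytope relative to its center. -/
noncomputable def tourVec (g : Equiv.Perm (Fin n)) : MatSpace n :=
  permAct g (cycleMat n) - symTSPCenter n

theorem tourVec_one : tourVec 1 = cycleMat n - symTSPCenter n := by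
  rw [tourVec, permAct_one]

theorem permAct_tourVec (g h : Equiv.Perm (Fin n)) : permAct g (tourVec h) = tourVec (g * h) := by
  rw [tourVec, permAct_sub, permAct_center, ← permAct_mul, tourVec]

theorem center_rowSum (hn : 4 ≤ n) (i : Fin n) : ∑ j, symTSPCenter n (i, j) = 2 := by
  have hn' : (4 : ℝ) ≤ n := by exact_mod_cast hn
  have h1 : (n : ℝ) - 1 ≠ 0 := by linarith
  have h : ∀ j, symTSPCenter n (i, j) =
      (1 - if i = j then 1 else 0) * (2 / ((n : ℝ) - 1)) := fun j => by
    rw [symTSPCenter_apply]; split_ifs <;> simp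
  simp only [h, ← Finset.sum_mul, Finset.sum_sub_distrib]
  simp
  field_simp

theorem tourVec_mem (hn : 4 ≤ n) (g : Equiv.Perm (Fin n)) : tourVec g ∈ tspDirection n := by
  have h : tourVec 1 ∈ tspDirection n := by
    rw [tourVec_one]
    refine ⟨fun i j => ?_, fun i => ?_, fun i => ?_⟩
    · simp [cycleMat_symm i j, symTSPCenter_apply, eq_comm]
    · simp [cycleMat_diag, symTSPCenter_apply]
    · simp [Finset.sum_sub_distrib, cycleMat_rowSum (by lia : 3 ≤ n), center_rowSum hn]
  have := permAct_mem h g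
  rwa [permAct_tourVec, mul_one] at this

theorem norm_sq_tourVec (hn : 4 ≤ n) (g : Equiv.Perm (Fin n)) :
    ‖tourVec g‖ ^ 2 = 2 * n * ((n : ℝ) - 3) / ((n : ℝ) - 1) := by
  have hn' : (4 : ℝ) ≤ n := by exact_mod_cast hn
  have h1 : (n : ℝ) - 1 ≠ 0 := by linarith
  -- The entries of the cycle are 0 or 1, so the square is linear in them and only row sums are
  -- needed.
  have h : ∀ i j : Fin n, (cycleMat n - symTSPCenter n) (i, j) ^ 2 =
      (1 - 2 * (2 / ((n : ℝ) - 1))) * cycleMat n (i, j) +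
        2 / ((n : ℝ) - 1) * symTSPCenter n (i, j) := by
    intro i j
    by_cases hij : i = j
    · subst hij; simp [cycleMat_diag, symTSPCenter_apply]
    · rw [PiLp.sub_apply, symTSPCenter_apply, if_neg hij]
      rcases cycleMat_eq_zero_or_one i j with h | h <;> rw [h] <;> ring
  rw [← mul_one g, ← permAct_tourVec, norm_permAct, tourVec_one, MatSpace.norm_sq_eq]
  simp only [h, Finset.sum_add_distrib, ← Finset.mul_sum, cycleMat_rowSum (by lia : 3 ≤ n),
    center_rowSum hn]
  simp
  field_simp
  ring

/-- The sum is invariant, so by 2-transitivity its off-diagonal entries agree; zero row sums make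
them zero. -/
theorem sum_tourVec (hn : 4 ≤ n) : ∑ g : Equiv.Perm (Fin n), tourVec g = 0 := by
  have hn' : (4 : ℝ) ≤ n := by exact_mod_cast hn
  set S : MatSpace n := ∑ g : Equiv.Perm (Fin n), tourVec g with hS
  have hmem : S ∈ tspDirection n := Submodule.sum_mem _ fun g _ => tourVec_mem hn g
  have hinv : ∀ h, permAct h S = S := fun h => by
    rw [hS, permAct_sum]
    simp only [permAct_tourVec]
    exact Equiv.sum_comp (Equiv.mulLeft h) tourVec
  have hconst : ∀ i j i' j', i ≠ j → i' ≠ j' → S (i', j') = S (i, j) := by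
    intro i j i' j' h h'
    obtain ⟨g, rfl, rfl⟩ := exists_perm_apply_eq h h'
    conv_lhs => rw [← hinv g]
    rw [permAct_apply_apply]
  ext ⟨i, j⟩
  show S (i, j) = 0
  by_cases hij : i = j
  · subst hij; exact hmem.2.1 i
  have h1 : ∀ l, S (i, l) = (1 - if i = l then 1 else 0) * S (i, j) := by
    intro l
    by_cases hl : i = l
    · subst hl; simp [hmem.2.1]
    · simp [hl, hconst i j i l hij hl]
  have h2 := hmem.2.2 i
  rw [Finset.sum_congr rfl fun l _ => h1 l, ← Finset.sum_mul] at h2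
  simp only [Finset.sum_sub_distrib, Finset.sum_ite_eq, Finset.mem_univ, if_true,
      Finset.sum_const, Finset.card_univ, Fintype.card_fin, nsmul_eq_mul, mul_one] at h2
  exact (mul_eq_zero.1 h2).resolve_left (by linarith)

/-- The sum of the relative vertices over the tours, weighted by the entry at `(i, j)`. -/
noncomputable def edgeTourSum (i j : Fin n) : MatSpace n :=
  ∑ g : Equiv.Perm (Fin n), permAct g (cycleMat n) (i, j) • tourVec g

theorem permAct_edgeTourSum (h : Equiv.Perm (Fin n)) (i j : Fin n) :
    permAct h (edgeTourSum i j) = edgeTourSum (h i) (h j) := by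
  rw [edgeTourSum, permAct_sum, edgeTourSum]
  refine Fintype.sum_equiv (Equiv.mulLeft h) _ _ fun g => ?_
  rw [permAct_smul, permAct_tourVec, Equiv.coe_mulLeft, permAct_mul, permAct_apply_apply]

theorem edgeTourSum_mem (hn : 4 ≤ n) (i j : Fin n) : edgeTourSum i j ∈ tspDirection n :=
  Submodule.sum_mem _ fun g _ => Submodule.smul_mem _ _ (tourVec_mem hn g)

/-- The stabilizer of (i, j) fixes `edgeTourSum i j`; moving one edge to another shows that the
factor is the same for all. -/
theorem exists_edgeTourSum_eq (hn : 4 ≤ n) :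
    ∃ κ : ℝ, ∀ i j : Fin n, i ≠ j → edgeTourSum i j = κ • coordVec i j := by
  obtain ⟨a, b, hab⟩ : ∃ a b : Fin n, a ≠ b := ⟨⟨0, by lia⟩, ⟨1, by lia⟩, by simp⟩
  refine ⟨edgeTourSum a b (a, b) / (((n : ℝ) - 3) / (2 * (n - 1))), fun i j hij => ?_⟩
  obtain ⟨g, rfl, rfl⟩ := exists_perm_apply_eq hab hij
  have := eq_smul_coordVec hn hij (edgeTourSum_mem hn (g a) (g b)) fun h hi hj => by
    rw [permAct_edgeTourSum, hi, hj]
  rwa [← permAct_edgeTourSum, permAct_apply_apply, permAct_edgeTourSum] at this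

theorem inner_center_eq_zero {x : MatSpace n} (hx : x ∈ tspDirection n) :
    inner ℝ (symTSPCenter n) x = 0 := by
  have h : ∀ i j, symTSPCenter n (i, j) * x (i, j) = 2 / ((n : ℝ) - 1) * x (i, j) := by
    intro i j
    by_cases hij : i = j
    · subst hij; rw [hx.2.1]; ring
    · rw [symTSPCenter_apply, if_neg hij]
  rw [MatSpace.inner_eq]
  simp [h, ← Finset.mul_sum, hx.2.2]

/-- Expand one factor of ⟨`tourVec g`, x⟩² in coordinates. Summing over g first produces
⟨`edgeTourSum i j`, x⟩ = κ x_ij, weighted by x_ij. -/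
theorem exists_tour_tight_frame (hn : 4 ≤ n) : ∃ κ : ℝ, 0 < κ ∧
    (∀ i j : Fin n, i ≠ j → edgeTourSum i j = κ • coordVec i j) ∧
    ∀ x ∈ tspDirection n, ∑ g, inner ℝ (tourVec g) x ^ 2 = κ * ‖x‖ ^ 2 := by
  obtain ⟨κ, hκ⟩ := exists_edgeTourSum_eq hn
  have hn' : (4 : ℝ) ≤ n := by exact_mod_cast hn
  have key : ∀ x ∈ tspDirection n, ∑ g, inner ℝ (tourVec g) x ^ 2 = κ * ‖x‖ ^ 2 := by
    intro x hx
    have h1 : ∀ g, inner ℝ (tourVec g) x ^ 2 =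
        ∑ i, ∑ j, permAct g (cycleMat n) (i, j) * x (i, j) * inner ℝ (tourVec g) x := by
      intro g
      simp only [← Finset.sum_mul]
      rw [← MatSpace.inner_eq, sq]
      congr 1
      rw [tourVec, inner_sub_left, inner_center_eq_zero hx, sub_zero]
    have h2 : ∀ i j, ∑ g, permAct g (cycleMat n) (i, j) * x (i, j) * inner ℝ (tourVec g) x =
        κ * x (i, j) ^ 2 := by
      intro i j
      by_cases hij : i = j
      · subst hij; simp [hx.2.1]
      have h3 : inner ℝ (edgeTourSum i j) x = κ * x (i, j) := by
        rw [hκ i j hij, real_inner_smul_left, inner_coordVec i j hx]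
      rw [edgeTourSum, sum_inner] at h3
      simp only [real_inner_smul_left] at h3
      rw [sq, ← mul_assoc, ← h3, Finset.sum_mul]
      exact Finset.sum_congr rfl fun g _ => by ring
    simp only [h1]
    rw [Finset.sum_comm, MatSpace.norm_sq_eq, Finset.mul_sum]
    refine Finset.sum_congr rfl fun i _ => ?_
    rw [Finset.sum_comm, Finset.mul_sum]
    exact Finset.sum_congr rfl fun j _ => h2 i j
  refine ⟨κ, ?_, hκ, key⟩
  have h1 := key (tourVec 1) (tourVec_mem hn 1)
  have h2 : 0 < ‖tourVec (1 : Equiv.Perm (Fin n))‖ ^ 2 := by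
    rw [norm_sq_tourVec hn]
    have : (0 : ℝ) < n - 3 := by linarith
    have : (0 : ℝ) < n - 1 := by linarith
    positivity
  have h3 : 0 < ∑ g : Equiv.Perm (Fin n), inner ℝ (tourVec g) (tourVec 1) ^ 2 := by
    refine Finset.sum_pos' (fun g _ => sq_nonneg _) ⟨1, Finset.mem_univ _, ?_⟩
    rw [real_inner_self_eq_norm_sq]
    positivity
  rw [h1] at h3
  exact pos_of_mul_pos_left h3 h2.le

/-! ### The affine hull -/

theorem symTSP_eq : symTSP n = convexHull ℝ (Set.range fun g : Equiv.Perm (Fin n) =>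
    symTSPCenter n + tourVec g) := by
  simp [symTSP, tourVec]

theorem tour_mem_symTSP (g : Equiv.Perm (Fin n)) : symTSPCenter n + tourVec g ∈ symTSP n := by
  rw [symTSP_eq]; exact subset_convexHull ℝ _ ⟨g, rfl⟩

theorem center_mem_symTSP (hn : 4 ≤ n) : symTSPCenter n ∈ symTSP n := by
  have hcard : (0 : ℝ) < Fintype.card (Equiv.Perm (Fin n)) := by exact_mod_cast Fintype.card_pos
  have h := (convex_convexHull ℝ (Set.range fun g : Equiv.Perm (Fin n) =>
    symTSPCenter n + tourVec g)).sum_mem (t := Finset.univ)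
    (w := fun _ : Equiv.Perm (Fin n) => (Fintype.card (Equiv.Perm (Fin n)) : ℝ)⁻¹)
    (z := fun g => symTSPCenter n + tourVec g) (fun _ _ => by positivity)
    (by rw [Finset.sum_const, Finset.card_univ, nsmul_eq_mul, mul_inv_cancel₀ hcard.ne'])
    (fun g _ => subset_convexHull ℝ _ ⟨g, rfl⟩)
  rw [← Finset.smul_sum, Finset.sum_add_distrib, sum_tourVec hn, add_zero, Finset.sum_const,
    Finset.card_univ, ← Nat.cast_smul_eq_nsmul ℝ, smul_smul, inv_mul_cancel₀ hcard.ne',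
    one_smul] at h
  rwa [symTSP_eq]

theorem sum_smul_coordVec (hn : 4 ≤ n) {x : MatSpace n} (hx : x ∈ tspDirection n) :
    ∑ i, ∑ j, x (i, j) • coordVec i j = x := by
  set y := ∑ i, ∑ j, x (i, j) • coordVec i j with hy
  have hmem : y ∈ tspDirection n := by
    refine Submodule.sum_mem _ fun i _ => Submodule.sum_mem _ fun j _ => ?_
    by_cases hij : i = j
    · subst hij; rw [hx.2.1, zero_smul]; exact Submodule.zero_mem _
    · exact Submodule.smul_mem _ _ (coordVec_mem hn hij)
  have h : ∀ z ∈ tspDirection n, inner ℝ (y - x) z = 0 := by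
    intro z hz
    rw [inner_sub_left, hy, sub_eq_zero, MatSpace.inner_eq x]
    simp only [sum_inner, real_inner_smul_left, inner_coordVec _ _ hz]
  exact sub_eq_zero.1 (inner_self_eq_zero.1 (h _ (Submodule.sub_mem _ hmem hx)))

/-- The tours span W because each `coordVec i j` equals κ⁻¹ times a combination of tours, and the
coordinate vectors reproduce every element of W. -/
theorem direction_symTSP (hn : 4 ≤ n) : (affineSpan ℝ (symTSP n)).direction = tspDirection n := by
  rw [direction_affineSpan]
  apply le_antisymm
  · rw [vectorSpan_eq_span_vsub_set_right ℝ (center_mem_symTSP hn), Submodule.span_le]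
    rintro _ ⟨x, hx, rfl⟩
    rw [symTSP_eq] at hx
    have : convexHull ℝ (Set.range fun g : Equiv.Perm (Fin n) => symTSPCenter n + tourVec g) ⊆
        {x | x - symTSPCenter n ∈ tspDirection n} := by
      refine convexHull_min ?_ ?_
      · rintro _ ⟨g, rfl⟩
        simpa using tourVec_mem hn g
      · intro x hx y hy a b ha hb hab
        have h : a • x + b • y - symTSPCenter n =
            a • (x - symTSPCenter n) + b • (y - symTSPCenter n) := by
          rw [smul_sub, smul_sub, sub_add_sub_comm, ← add_smul, hab, one_smul]
        show a • x + b • y - symTSPCenter n ∈ tspDirection n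
        rw [h]
        exact Submodule.add_mem _ (Submodule.smul_mem _ _ hx) (Submodule.smul_mem _ _ hy)
    exact this hx
  · intro x hx
    obtain ⟨κ, hκ, hedge, hframe⟩ := exists_tour_tight_frame hn
    have htour : ∀ g, tourVec g ∈ vectorSpan ℝ (symTSP n) := fun g => by
      have := vsub_mem_vectorSpan ℝ (tour_mem_symTSP g) (center_mem_symTSP hn)
      simpa using this
    set U := vectorSpan ℝ (symTSP n)
    have hUx : ∀ i j, i ≠ j → coordVec i j ∈ U := by
      intro i j hij
      have h : coordVec i j = κ⁻¹ • edgeTourSum i j := by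
        rw [hedge i j hij, smul_smul, inv_mul_cancel₀ hκ.ne', one_smul]
      rw [h]
      exact Submodule.smul_mem _ _ (Submodule.sum_mem _ fun g _ =>
        Submodule.smul_mem _ _ (htour g))
    rw [← sum_smul_coordVec hn hx]
    refine Submodule.sum_mem _ fun i _ => Submodule.sum_mem _ fun j _ => ?_
    by_cases hij : i = j
    · subst hij; rw [hx.2.1, zero_smul]; exact Submodule.zero_mem _
    · exact Submodule.smul_mem _ _ (hUx i j hij)

theorem mem_affineSpan_symTSP (hn : 4 ≤ n) {x : MatSpace n} :
    x ∈ affineSpan ℝ (symTSP n) ↔ x - symTSPCenter n ∈ tspDirection n := by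
  rw [← direction_symTSP hn]
  exact (AffineSubspace.vsub_right_mem_direction_iff_mem
    (subset_affineSpan ℝ _ (center_mem_symTSP hn)) x).symm

theorem mem_affineSpan_symTSP_iff (hn : 4 ≤ n) (x : MatSpace n) :
    x ∈ affineSpan ℝ (symTSP n) ↔ (∀ i j, x (i, j) = x (j, i)) ∧ (∀ i, x (i, i) = 0) ∧
      (∀ i, ∑ j, x (i, j) = 2) ∧ (∀ j, ∑ i, x (i, j) = 2) := by
  rw [mem_affineSpan_symTSP hn, mem_tspDirection]
  have hc : ∀ i j, symTSPCenter n (i, j) = symTSPCenter n (j, i) := fun i j => by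
    simp only [symTSPCenter_apply, eq_comm]
  have hd : ∀ i, symTSPCenter n (i, i) = 0 := fun i => by simp [symTSPCenter_apply]
  simp only [PiLp.sub_apply, Finset.sum_sub_distrib, center_rowSum hn, hd, sub_zero, sub_eq_zero]
  constructor
  · rintro ⟨h1, h2, h3⟩
    have h1' : ∀ i j, x (i, j) = x (j, i) := fun i j => by
      have := h1 i j
      rw [hc i j] at this
      linarith
    refine ⟨h1', h2, h3, fun j => ?_⟩
    rw [← h3 j]
    exact Finset.sum_congr rfl fun i _ => h1' i j
  · rintro ⟨h1, h2, h3, -⟩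
    exact ⟨fun i j => by rw [h1 i j, hc i j], h2, h3⟩

end TSP

/-! ### Decomposition of the complete graph into sum classes and tours. -/

section ZigzagTours

variable {N : ℕ}

/-- The graph on `ZMod N ∪ {∞}` whose edges are the pairs with sum `s`, together with the edges from
`∞` to the solutions of `2 a = s`. -/
def sumGraph (s : ZMod N) : Option (ZMod N) → Option (ZMod N) → ℝ
  | none, none => 0
  | none, some b => if b + b = s then 1 else 0
  | some a, none => if a + a = s then 1 else 0
  | some a, some b => if a ≠ b ∧ a + b = s then 1 else 0

theorem sumGraph_symm (s : ZMod N) (x y : Option (ZMod N)) : sumGraph s x y = sumGraph s y x := by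
  cases x <;> cases y <;> simp [sumGraph, add_comm, eq_comm]

theorem sumGraph_nonneg (s : ZMod N) (x y : Option (ZMod N)) : 0 ≤ sumGraph s x y := by
  cases x <;> cases y <;> simp only [sumGraph] <;> first | exact le_rfl | (split_ifs <;> norm_num)

/-- The neighbor of a is s - a, or ∞ when s - a = a. The degree of ∞ is not always 1: for even N it
is 0 or 2. -/
theorem sumGraph_rowSum [NeZero N] (s a : ZMod N) : ∑ y, sumGraph s (some a) y = 1 := by
  have h : ∀ b, sumGraph s (some a) (some b) = (if b = s - a then 1 else 0) -
      (if b = a then (if a + a = s then 1 else 0) else 0) := by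
    intro b
    have h1 : b = s - a ↔ a + b = s := by rw [eq_sub_iff_add_eq, add_comm]
    simp only [sumGraph, h1]
    by_cases hab : a = b
    · subst hab; simp
    · simp [hab, Ne.symm hab]
  rw [Fintype.sum_option]
  simp only [h, Finset.sum_sub_distrib]
  simp [sumGraph]

theorem sum_sumGraph [NeZero N] (x y : Option (ZMod N)) :
    ∑ s, sumGraph s x y = if x = y then 0 else 1 := by
  cases x with
  | none => cases y <;> simp [sumGraph]
  | some a =>
    cases y with
    | none => simp [sumGraph]
    | some b => by_cases h : a = b <;> simp [sumGraph, h]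

/-- Translations, like unit multiplications below, permute the sum classes, so one tour yields many.
-/
theorem sumGraph_shift (s t : ZMod N) (x y : Option (ZMod N)) :
    sumGraph s (x.map (· - t)) (y.map (· - t)) = sumGraph (s + t + t) x y := by
  have h : ∀ a b : ZMod N, a - t + (b - t) = s ↔ a + b = s + t + t := fun a b => by
    rw [← sub_eq_zero, ← sub_eq_zero (a := a + b)]; ring_nf
  cases x <;> cases y <;> simp [sumGraph, h]

theorem sumGraph_mul (u : (ZMod N)ˣ) (s : ZMod N) (x y : Option (ZMod N)) :
    sumGraph (u * s : ZMod N) (x.map fun a => (u * a : ZMod N)) (y.map fun a => (u * a : ZMod N)) =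
      sumGraph s x y := by
  cases x <;> cases y <;> simp only [sumGraph, Option.map_some, Option.map_none, ← mul_add,
    u.mul_right_inj, ne_eq]

/-- The zigzag path `0, 1, -1, 2, -2, …`. -/
def zigzag (j : ℕ) : ℤ := if j % 2 = 0 then -(j / 2 : ℕ) else ((j + 1) / 2 : ℕ)

/-- The zigzag path in `ZMod N`, closed by `∞`. -/
def zigzagTour (N : ℕ) (k : Fin (N + 1)) : Option (ZMod N) :=
  if (k : ℕ) = 0 then none else some (zigzag (k - 1) : ZMod N)

/-- The first N values lie in an interval of length less than N, so congruent values are equal. -/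
theorem zigzag_injOn {j k : ℕ} (hj : j < N) (hk : k < N)
    (h : (zigzag j : ZMod N) = (zigzag k : ZMod N)) : j = k := by
  rw [ZMod.intCast_eq_intCast_iff_dvd_sub] at h
  have h1 : zigzag k - zigzag j = 0 := by
    refine Int.eq_zero_of_abs_lt_dvd h ?_
    rw [abs_lt]
    unfold zigzag
    split_ifs <;> omega
  unfold zigzag at h1
  split_ifs at h1 <;> omega

theorem zigzagTour_bijective [NeZero N] : Function.Bijective (zigzagTour N) := by
  rw [Fintype.bijective_iff_injective_and_card]
  constructor
  · intro j k h
    unfold zigzagTour at h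
    have hj := j.2
    have hk := k.2
    split_ifs at h with h1 h2 h2
    · exact Fin.ext (by omega)
    · have := zigzag_injOn (by omega) (by omega) (Option.some.inj h)
      exact Fin.ext (by omega)
  · simp [ZMod.card]

theorem zigzag_add_succ (j : ℕ) : zigzag j + zigzag (j + 1) = 0 ∨ zigzag j + zigzag (j + 1) = 1 := by
  unfold zigzag
  split_ifs <;> omega

theorem one_le_sumGraph_zigzagTour (hN : 3 ≤ N) {i j : Fin (N + 1)} (h : (j - i).val = 1) :
    1 ≤ sumGraph 0 (zigzagTour N i) (zigzagTour N j) +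
      sumGraph 1 (zigzagTour N i) (zigzagTour N j) := by
  have hi := i.2
  have hj := j.2
  have hor : ∀ x y, sumGraph (0 : ZMod N) x y = 1 ∨ sumGraph (1 : ZMod N) x y = 1 →
      1 ≤ sumGraph (0 : ZMod N) x y + sumGraph 1 x y := by
    rintro x y (h | h)
    · have := sumGraph_nonneg (1 : ZMod N) x y; linarith
    · have := sumGraph_nonneg (0 : ZMod N) x y; linarith
  apply hor
  rcases le_or_gt i j with hle | hlt
  · rw [Fin.sub_val_of_le hle] at h
    have hle' : (i : ℕ) ≤ j := hle
    -- The tour starts with the edge from ∞ to 0, and 0 + 0 = 0.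
    by_cases hi0 : (i : ℕ) = 0
    · left
      have hj1 : (j : ℕ) = 1 := by omega
      simp [zigzagTour, hi0, hj1, zigzag, sumGraph]
    · have hj1 : (j : ℕ) - 1 = (i : ℕ) - 1 + 1 := by omega
      have hj0 : (j : ℕ) ≠ 0 := by omega
      have hne : (zigzag (i - 1) : ZMod N) ≠ (zigzag (i - 1 + 1) : ZMod N) := fun h => by
        have := zigzag_injOn (by omega) (by omega) h
        omega
      simp only [zigzagTour, hi0, hj0, if_false, hj1, sumGraph, hne, ne_eq, not_false_eq_true,
        true_and, ite_eq_left_iff, zero_ne_one, imp_false, not_not]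
      rcases zigzag_add_succ ((i : ℕ) - 1) with h0 | h0
      · left; rw [← Int.cast_add, h0, Int.cast_zero]
      · right; rw [← Int.cast_add, h0, Int.cast_one]
  · have h1 : ((j - i : Fin (N + 1)) : ℕ) = N + 1 + j - i := Fin.coe_sub_iff_lt.2 hlt
    have hlt' : (j : ℕ) < i := hlt
    have hj0 : (j : ℕ) = 0 := by omega
    have hiN : (i : ℕ) = N := by omega
    have hN0 : N ≠ 0 := by omega
    simp only [zigzagTour, hj0, hiN, hN0, if_true, if_false, sumGraph, ite_eq_left_iff,
      zero_ne_one, imp_false, not_not]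
    -- The closing edge returns from the last vertex to ∞: twice this vertex is N ≡ 0 for even N and
    -- 1 - N ≡ 1 for odd N.
    rcases Nat.even_or_odd' N with ⟨m, hm | hm⟩
    · left
      have : zigzag (N - 1) + zigzag (N - 1) = (N : ℕ) := by
        unfold zigzag; split_ifs <;> omega
      rw [← Int.cast_add, this]; simp
    · right
      have : zigzag (N - 1) + zigzag (N - 1) = 1 - (N : ℕ) := by
        unfold zigzag; split_ifs <;> omega
      rw [← Int.cast_add, this]; simp

/-- Every cycle edge lies in class 0 or 1; in the row of a finite vertex both sides sum to 2, which
forces equality. The row of ∞ follows by symmetry. -/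
theorem cycleMat_eq_sumGraph [NeZero N] (hN : 3 ≤ N) (i j : Fin (N + 1)) :
    cycleMat (N + 1) (i, j) = sumGraph 0 (zigzagTour N i) (zigzagTour N j) +
      sumGraph 1 (zigzagTour N i) (zigzagTour N j) := by
  have hle : ∀ i j, cycleMat (N + 1) (i, j) ≤ sumGraph 0 (zigzagTour N i) (zigzagTour N j) +
      sumGraph 1 (zigzagTour N i) (zigzagTour N j) := by
    intro i j
    by_cases h : (SimpleGraph.cycleGraph (N + 1)).Adj i j
    · have h1 : cycleMat (N + 1) (i, j) = 1 := by simp [cycleMat, SimpleGraph.adjMatrix_apply, h]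
      rw [h1]
      rcases SimpleGraph.cycleGraph_adj'.1 h with h | h
      · rw [sumGraph_symm, sumGraph_symm 1]; exact one_le_sumGraph_zigzagTour hN h
      · exact one_le_sumGraph_zigzagTour hN h
    · have h1 : cycleMat (N + 1) (i, j) = 0 := by simp [cycleMat, SimpleGraph.adjMatrix_apply, h]
      rw [h1]
      exact add_nonneg (sumGraph_nonneg _ _ _) (sumGraph_nonneg _ _ _)
  have hsome : ∀ i a, zigzagTour N i = some a → ∀ j, cycleMat (N + 1) (i, j) =
      sumGraph 0 (zigzagTour N i) (zigzagTour N j) +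
      sumGraph 1 (zigzagTour N i) (zigzagTour N j) := by
    intro i a ha j
    have hsum : ∑ j, cycleMat (N + 1) (i, j) =
        ∑ j, (sumGraph 0 (zigzagTour N i) (zigzagTour N j) +
          sumGraph 1 (zigzagTour N i) (zigzagTour N j)) := by
      rw [cycleMat_rowSum (by omega), ha,
        zigzagTour_bijective.sum_comp fun y => sumGraph 0 (some a) y + sumGraph 1 (some a) y,
        Finset.sum_add_distrib, sumGraph_rowSum, sumGraph_rowSum]
      norm_num
    exact (Finset.sum_eq_sum_iff_of_le fun j _ => hle i j).1 hsum j (Finset.mem_univ j)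
  cases hi : zigzagTour N i with
  | some a => rw [← hi]; exact hsome i a hi j
  | none =>
    cases hj : zigzagTour N j with
    | some b => rw [cycleMat_symm, hsome j b hj i, hi, hj, sumGraph_symm, sumGraph_symm 1]
    | none =>
      have : i = j := zigzagTour_bijective.1 (hi.trans hj.symm)
      subst this
      simp [cycleMat_diag, sumGraph]

/-- The matrix of a weighted graph on `ZMod N ∪ {∞}` in the labels of the zigzag tour. -/
def zigzagMat (s : ZMod N) : MatSpace (N + 1) :=
  WithLp.toLp 2 fun p => sumGraph s (zigzagTour N p.1) (zigzagTour N p.2)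

theorem zigzagMat_apply (s : ZMod N) (i j : Fin (N + 1)) :
    zigzagMat s (i, j) = sumGraph s (zigzagTour N i) (zigzagTour N j) := rfl

theorem cycleMat_eq_zigzagMat [NeZero N] (hN : 3 ≤ N) :
    cycleMat (N + 1) = zigzagMat 0 + zigzagMat 1 := by
  ext ⟨i, j⟩
  exact cycleMat_eq_sumGraph hN i j

theorem sum_zigzagMat_apply [NeZero N] (i j : Fin (N + 1)) :
    (∑ s : ZMod N, zigzagMat s) (i, j) = if i = j then 0 else 1 := by
  rw [WithLp.ofLp_sum, Finset.sum_apply]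
  simp only [zigzagMat_apply, sum_sumGraph, zigzagTour_bijective.1.eq_iff]

/-- The pairs `(s, t)` for which the sum graphs of `s` and `t` form a tour. -/
def IsTourPair (s t : ZMod N) : Prop :=
  ∃ g : Equiv.Perm (Fin (N + 1)), zigzagMat s + zigzagMat t = permAct g (cycleMat (N + 1))

theorem IsTourPair.of_perm [NeZero N] {s t s' t' : ZMod N} (h : IsTourPair s t)
    (σ : Equiv.Perm (Option (ZMod N))) (hs : ∀ x y, sumGraph s (σ x) (σ y) = sumGraph s' x y)
    (ht : ∀ x y, sumGraph t (σ x) (σ y) = sumGraph t' x y) : IsTourPair s' t' := by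
  obtain ⟨g, hg⟩ := h
  let e := Equiv.ofBijective (zigzagTour N) zigzagTour_bijective
  let τ : Equiv.Perm (Fin (N + 1)) := (e.trans σ).trans e.symm
  have hτ : ∀ i, zigzagTour N (τ i) = σ (zigzagTour N i) := fun i =>
    e.apply_symm_apply (σ (e i))
  refine ⟨τ⁻¹ * g, ?_⟩
  rw [permAct_mul, ← hg]
  ext ⟨i, j⟩
  rw [permAct_apply, inv_inv]
  simp only [PiLp.add_apply, zigzagMat_apply, hτ, hs, ht]

theorem IsTourPair.zero_one [NeZero N] (hN : 3 ≤ N) : IsTourPair (0 : ZMod N) 1 :=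
  ⟨1, by rw [permAct_one, cycleMat_eq_zigzagMat hN]⟩

theorem IsTourPair.shift [NeZero N] {s t : ZMod N} (h : IsTourPair s t) (r : ZMod N) :
    IsTourPair (s + r + r) (t + r + r) :=
  h.of_perm (Equiv.optionCongr (Equiv.subRight r)) (fun x y => sumGraph_shift s r x y)
    fun x y => sumGraph_shift t r x y

theorem IsTourPair.mul [NeZero N] {s t : ZMod N} (h : IsTourPair s t) (u : (ZMod N)ˣ) :
    IsTourPair (u * s : ZMod N) (u * t : ZMod N) :=
  h.of_perm (Equiv.optionCongr (Units.mulLeft u⁻¹))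
    (fun x y => by
      conv_lhs => rw [← u.inv_mul_cancel_left s]
      exact sumGraph_mul u⁻¹ _ x y)
    fun x y => by
      conv_lhs => rw [← u.inv_mul_cancel_left t]
      exact sumGraph_mul u⁻¹ _ x y

theorem IsTourPair.mem [NeZero N] {s t : ZMod N} (h : IsTourPair s t) :
    zigzagMat s + zigzagMat t ∈ symTSP (N + 1) := by
  obtain ⟨g, hg⟩ := h
  rw [hg]
  exact subset_convexHull ℝ _ ⟨g, rfl⟩

theorem sum_zmod_eq_sum_range [NeZero N] {M : Type*} [AddCommMonoid M] (f : ZMod N → M) :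
    ∑ s, f s = ∑ k ∈ Finset.range N, f k := by
  refine (Finset.sum_nbij (fun k : ℕ => (k : ZMod N)) (fun _ _ => Finset.mem_univ _) ?_ ?_
    fun _ _ => rfl).symm
  · intro a ha b hb hab
    simp only [Finset.coe_range, Set.mem_Iio] at ha hb
    rw [ZMod.natCast_eq_natCast_iff', Nat.mod_eq_of_lt ha, Nat.mod_eq_of_lt hb] at hab
    exact hab
  · intro s _
    exact ⟨s.val, by simpa using ZMod.val_lt s, ZMod.natCast_zmod_val s⟩

open scoped Pointwise in
/-- Sums of `K` points of a convex set `C` lie in `K • C`. -/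
theorem Convex.sum_range_mem_smul {E : Type*} [AddCommGroup E] [Module ℝ E] {C : Set E}
    (hC : Convex ℝ C) (hne : C.Nonempty) {z : ℕ → E} (K : ℕ) (hz : ∀ t < K, z t ∈ C) :
    ∑ t ∈ Finset.range K, z t ∈ (K : ℝ) • C := by
  induction K with
  | zero => obtain ⟨c, hc⟩ := hne; exact ⟨c, hc, by simp⟩
  | succ K ih =>
    rw [Finset.sum_range_succ, Nat.cast_succ, hC.add_smul (by positivity) zero_le_one]
    exact Set.add_mem_add (ih fun t ht => hz t (by omega)) ⟨z K, hz K (by omega), by simp⟩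

theorem sum_range_two_mul {M : Type*} [AddCommMonoid M] (f : ℕ → M) (K : ℕ) :
    ∑ k ∈ Finset.range (2 * K), f k = ∑ t ∈ Finset.range K, (f (2 * t) + f (2 * t + 1)) := by
  induction K with
  | zero => simp
  | succ K ih => rw [Finset.sum_range_succ, ← ih, Nat.mul_succ, Finset.sum_range_succ,
      Finset.sum_range_succ, add_assoc]

theorem Convex.symTSP (n : ℕ) : Convex ℝ (symTSP n) := convex_convexHull ℝ _

theorem symTSP_nonempty (n : ℕ) : (symTSP n).Nonempty :=
  ⟨_, subset_convexHull ℝ _ ⟨1, rfl⟩⟩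

open scoped Pointwise in
/-- Twice the complement of the cycle is a sum of `N - 2` tours. -/
theorem two_smul_complement_mem [NeZero N] (hN : 4 ≤ N) :
    (2 : ℝ) • (∑ s : ZMod N, zigzagMat s - cycleMat (N + 1)) ∈
      ((N : ℝ) - 2) • symTSP (N + 1) := by
  rw [cycleMat_eq_zigzagMat (by omega), sum_zmod_eq_sum_range]
  have hC := Convex.symTSP (N + 1)
  have hne := symTSP_nonempty (N + 1)
  have hcons : ∀ r : ZMod N, IsTourPair (r + r) (r + r + 1) := fun r => by
    have := (IsTourPair.zero_one (N := N) (by omega)).shift r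
    rwa [zero_add, add_assoc, add_comm 1] at this
  rcases Nat.even_or_odd' N with ⟨M, hM | hM⟩
  -- For even N the remaining classes 2, …, N-1 split into the pairs (2r, 2r+1).
  · have hpair : ∀ t : ℕ, zigzagMat ((2 * t + 2 : ℕ) : ZMod N) + zigzagMat ((2 * t + 3 : ℕ) : ZMod N)
        ∈ symTSP (N + 1) := fun t => by
      have := (hcons ((t + 1 : ℕ) : ZMod N)).mem
      convert this using 3 <;> push_cast <;> ring
    have h1 := hC.sum_range_mem_smul hne (M - 1) fun t _ => hpair t
    have h2 : ∑ k ∈ Finset.range N, zigzagMat (k : ZMod N) - (zigzagMat 0 + zigzagMat 1) =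
        ∑ t ∈ Finset.range (M - 1), (zigzagMat ((2 * t + 2 : ℕ) : ZMod N) +
          zigzagMat ((2 * t + 3 : ℕ) : ZMod N)) := by
      rw [← sum_range_two_mul fun k => zigzagMat ((k + 2 : ℕ) : ZMod N),
        show Finset.range N = Finset.range (2 * (M - 1) + 2) by congr 1; omega,
        Finset.sum_range_succ', Finset.sum_range_succ']
      push_cast
      norm_num [add_assoc]
      abel
    rw [h2]
    have h3 : (N : ℝ) - 2 = 2 * ((M - 1 : ℕ) : ℝ) := by
      rw [Nat.cast_sub (by omega), hM]; push_cast; ring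
    rw [h3, mul_smul]
    exact Set.smul_mem_smul_set h1
  · have hcop : Nat.Coprime 2 N := by rw [hM]; simp
    let u : (ZMod N)ˣ := ZMod.unitOfCoprime 2 hcop
    have hu : (u : ZMod N) = 2 := by simp [u]
    -- For odd N, 2 is invertible, so every s has the form r + r.
    have hall : ∀ s : ZMod N, IsTourPair s (s + 1) := fun s => by
      have := hcons (↑u⁻¹ * s)
      rwa [← two_mul, ← hu, Units.mul_inv_cancel_left] at this
    -- An odd number of classes remains. Classes 2, 3, 4, taken twice, give the tours (2,3), (3,4)
    -- and (2,4), the last being twice (1,2); classes 5, …, N-1 are paired.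
    have h24 : IsTourPair (2 : ZMod N) 4 := by
      have := (hall 1).mul u
      rwa [hu, mul_one, show (2 : ZMod N) * (1 + 1) = 4 by norm_num] at this
    have hpair : ∀ t : ℕ, zigzagMat ((2 * t + 5 : ℕ) : ZMod N) + zigzagMat ((2 * t + 6 : ℕ) : ZMod N)
        ∈ symTSP (N + 1) := fun t => by
      have := (hall ((2 * t + 5 : ℕ) : ZMod N)).mem
      convert this using 3
      push_cast; ring
    have h1 := hC.sum_range_mem_smul hne (M - 2) fun t _ => hpair t
    have h2 : ∑ k ∈ Finset.range N, zigzagMat (k : ZMod N) - (zigzagMat 0 + zigzagMat 1) =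
        zigzagMat 2 + zigzagMat 3 + zigzagMat 4 +
        ∑ t ∈ Finset.range (M - 2), (zigzagMat ((2 * t + 5 : ℕ) : ZMod N) +
          zigzagMat ((2 * t + 6 : ℕ) : ZMod N)) := by
      rw [← sum_range_two_mul fun k => zigzagMat ((k + 5 : ℕ) : ZMod N),
        show Finset.range N = Finset.range (2 * (M - 2) + 5) by congr 1; omega,
        Finset.sum_range_succ', Finset.sum_range_succ', Finset.sum_range_succ',
        Finset.sum_range_succ', Finset.sum_range_succ']
      push_cast
      norm_num [add_assoc]
      abel
    rw [h2]
    have h3 : (N : ℝ) - 2 = 1 + 1 + 1 + 2 * ((M - 2 : ℕ) : ℝ) := by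
      rw [Nat.cast_sub (by omega), hM]; push_cast; ring
    have h23 := (hall 2).mem
    have h34 := (hall 3).mem
    rw [show (2 : ZMod N) + 1 = 3 by norm_num] at h23
    rw [show (3 : ZMod N) + 1 = 4 by norm_num] at h34
    rw [h3, hC.add_smul (by positivity) (by positivity), hC.add_smul (by positivity) zero_le_one,
      hC.add_smul zero_le_one zero_le_one, mul_smul, one_smul]
    have h4 : ∀ a b c d : MatSpace (N + 1), (2 : ℝ) • (a + b + c + d) =
        (a + b) + (b + c) + (a + c) + (2 : ℝ) • d := fun a b c d => by
      simp only [two_smul]; abel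
    rw [h4]
    exact Set.add_mem_add (Set.add_mem_add (Set.add_mem_add h23 h34) h24.mem)
      (Set.smul_mem_smul_set h1)

end ZigzagTours

/-! ### The symmetry coefficient. -/

section TSP

variable {n : ℕ}

/-- With N = n-1, the reflected point is 2/(N-2) times the complement of the cycle. -/
theorem reflect_cycle_mem (hn : 5 ≤ n) :
    symTSPCenter n - (2 / ((n : ℝ) - 3)) • tourVec 1 ∈ symTSP n := by
  obtain ⟨N, rfl⟩ : ∃ N, n = N + 1 := ⟨n - 1, by omega⟩
  have : NeZero N := ⟨by omega⟩
  have hN : (4 : ℝ) ≤ N := by exact_mod_cast (by omega : 4 ≤ N)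
  have h0 : (N : ℝ) ≠ 0 := by linarith
  have h2 : (N : ℝ) - 2 ≠ 0 := by linarith
  obtain ⟨y, hy, hy'⟩ := two_smul_complement_mem (N := N) (by omega)
  convert hy using 1
  have : y = ((N : ℝ) - 2)⁻¹ • (2 : ℝ) • (∑ s : ZMod N, zigzagMat s - cycleMat (N + 1)) := by
    rw [← hy', smul_smul, inv_mul_cancel₀ h2, one_smul]
  rw [this, tourVec_one]
  ext ⟨i, j⟩
  simp only [PiLp.sub_apply, PiLp.smul_apply, smul_eq_mul, sum_zigzagMat_apply, symTSPCenter_apply,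
    Nat.cast_add, Nat.cast_one]
  have h3 : (N : ℝ) + 1 - 3 = N - 2 := by ring
  have h4 : (N : ℝ) + 1 - 1 = N := by ring
  rw [h3, h4]
  by_cases hij : i = j
  · subst hij; simp [cycleMat_diag]
  · simp only [hij, if_false]
    field_simp
    ring

end TSP

section TSP

variable {n : ℕ}

theorem symTSP_nonneg {x : MatSpace n} (hx : x ∈ symTSP n) (i j : Fin n) : 0 ≤ x (i, j) := by
  have : symTSP n ⊆ {x | 0 ≤ x (i, j)} := by
    refine convexHull_min ?_ ?_
    · rintro _ ⟨g, rfl⟩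
      exact cycleMat_nonneg _ _
    · intro x hx y hy a b ha hb _
      exact add_nonneg (mul_nonneg ha hx) (mul_nonneg hb hy)
  exact this hx

theorem permAct_mem_symTSP {x : MatSpace n} (hx : x ∈ symTSP n) (g : Equiv.Perm (Fin n)) :
    permAct g x ∈ symTSP n := by
  have : symTSP n ⊆ {x | permAct g x ∈ symTSP n} := by
    refine convexHull_min ?_ ?_
    · rintro _ ⟨h, rfl⟩
      show permAct g (permAct h (cycleMat n)) ∈ symTSP n
      rw [← permAct_mul]
      exact subset_convexHull ℝ _ ⟨g * h, rfl⟩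
    · intro x hx y hy a b ha hb hab
      exact Convex.symTSP n hx hy ha hb hab
  exact this hx

theorem reflect_tour_mem (hn : 5 ≤ n) (g : Equiv.Perm (Fin n)) :
    symTSPCenter n - (2 / ((n : ℝ) - 3)) • tourVec g ∈ symTSP n := by
  have := permAct_mem_symTSP (reflect_cycle_mem hn) g
  rwa [permAct_sub, permAct_center, permAct_smul, permAct_tourVec, mul_one] at this

theorem reflect_mem (hn : 5 ≤ n) {x : MatSpace n} (hx : x ∈ symTSP n) :
    symTSPCenter n - (2 / ((n : ℝ) - 3)) • (x - symTSPCenter n) ∈ symTSP n := by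
  have : symTSP n ⊆
      {x | symTSPCenter n - (2 / ((n : ℝ) - 3)) • (x - symTSPCenter n) ∈ symTSP n} := by
    nth_rewrite 1 [symTSP_eq]
    refine convexHull_min ?_ ?_
    · rintro _ ⟨g, rfl⟩
      simpa using reflect_tour_mem hn g
    · intro x hx y hy a b ha hb hab
      have h := Convex.symTSP n hx hy ha hb hab
      have hc : symTSPCenter n = a • symTSPCenter n + b • symTSPCenter n := by
        rw [← add_smul, hab, one_smul]
      show symTSPCenter n - (2 / ((n : ℝ) - 3)) • (a • x + b • y - symTSPCenter n) ∈ symTSP n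
      convert h using 1
      nth_rewrite 1 2 [hc]
      module
  exact this hx

theorem isSymmetryCoefficient_symTSP (hn : 5 ≤ n) :
    IsSymmetryCoefficient (symTSP n) (symTSPCenter n) (2 / ((n : ℝ) - 3)) := by
  have hn' : (5 : ℝ) ≤ n := by exact_mod_cast hn
  have h3 : (0 : ℝ) < n - 3 := by linarith
  have h1 : (0 : ℝ) < n - 1 := by linarith
  refine ⟨⟨by positivity, fun x hx => reflect_mem hn hx⟩, ?_⟩
  rintro t ⟨-, ht⟩
  have hone : ∃ j : Fin n, cycleMat n (⟨0, by lia⟩, j) = 1 := by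
    by_contra! h
    have h0 := cycleMat_rowSum (n := n) (by lia) ⟨0, by lia⟩
    rw [Finset.sum_eq_zero fun j _ => (cycleMat_eq_zero_or_one _ j).resolve_right (h j)] at h0
    norm_num at h0
  obtain ⟨j, hj⟩ := hone
  have hne : (⟨0, by lia⟩ : Fin n) ≠ j := by
    rintro rfl
    rw [cycleMat_diag] at hj
    norm_num at hj
  -- At an edge of the cycle the reflected entry is (2 - t(n-3))/(n-1), and it must be nonnegative.
  have h := symTSP_nonneg (ht _ (tour_mem_symTSP 1)) ⟨0, by lia⟩ j
  rw [add_sub_cancel_left, tourVec_one] at h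
  simp only [PiLp.sub_apply, PiLp.smul_apply, smul_eq_mul, hj, symTSPCenter_apply, if_neg hne] at h
  rw [le_div_iff₀ h3]
  have h5 : (2 / ((n : ℝ) - 1) - t * (1 - 2 / ((n : ℝ) - 1))) * (n - 1) = 2 - t * (n - 3) := by
    field_simp
    ring
  have := mul_nonneg h h1.le
  rw [h5] at this
  linarith

/-! ### The two extremal ellipsoids of the polytope. -/

theorem finrank_tspDirection_pos (hn : 4 ≤ n) : 0 < finrank ℝ (tspDirection n) := by
  have hn' : (4 : ℝ) ≤ n := by exact_mod_cast hn
  have h := finrank_tspDirection hn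
  have : (0 : ℝ) < finrank ℝ (tspDirection n) := by rw [h]; nlinarith
  exact_mod_cast this

/-- The relative vertices of the polytope as elements of the direction of its affine hull. -/
noncomputable def tourVecIn (hn : 4 ≤ n) (g : Equiv.Perm (Fin n)) : tspDirection n :=
  ⟨tourVec g, tourVec_mem hn g⟩

theorem tour_frame_constant (hn : 4 ≤ n) {κ : ℝ}
    (hκ : ∀ x ∈ tspDirection n, ∑ g, inner ℝ (tourVec g) x ^ 2 = κ * ‖x‖ ^ 2) :
    κ * finrank ℝ (tspDirection n) = Fintype.card (Equiv.Perm (Fin n)) *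
      (2 * n * ((n : ℝ) - 3) / ((n : ℝ) - 1)) := by
  rw [tight_frame_trace (y := tourVecIn hn) (R := ‖tourVec (1 : Equiv.Perm (Fin n))‖) (κ := κ)
    (fun g => ?_) fun x => hκ x x.2, norm_sq_tourVec hn]
  rw [← norm_permAct g (tourVec 1), permAct_tourVec, mul_one]
  rfl

/-- Separate a missing point by f. The variance of f over the vertices is κ‖a‖² over their number,
and the two-sided bound on f from the symmetry coefficient limits it. -/
theorem ball_subset_symTSP (hn : 5 ≤ n) : ballInHull (symTSP n) (symTSPCenter n)
    (Real.sqrt (8 / (((n : ℝ) - 1) * ((n : ℝ) - 3)))) ⊆ symTSP n := by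
  have hn4 : 4 ≤ n := by lia
  have hn' : (5 : ℝ) ≤ n := by exact_mod_cast hn
  have h3 : (0 : ℝ) < n - 3 := by linarith
  have h1 : (0 : ℝ) < n - 1 := by linarith
  rintro x ⟨hx, hd⟩
  rw [mem_affineSpan_symTSP hn4] at hx
  rw [dist_eq_norm] at hd
  by_contra hxn
  obtain ⟨κ, hκ, -, hframe⟩ := exists_tour_tight_frame hn4
  obtain ⟨f, s, hf, hfx⟩ := geometric_hahn_banach_closed_point (Convex.symTSP n)
    ((Set.finite_range _).isClosed_convexHull ℝ) hxn
  -- Only the part of f along W matters; the tight frame identity is applied to its Riesz vector.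
  let a : tspDirection n := (InnerProductSpace.toDual ℝ (tspDirection n)).symm
    (f.comp (tspDirection n).subtypeL)
  have ha : ∀ y ∈ tspDirection n, inner ℝ (a : MatSpace n) y = f y := fun y hy =>
    InnerProductSpace.toDual_symm_apply (x := (⟨y, hy⟩ : tspDirection n))
      (y := f.comp (tspDirection n).subtypeL)
  set c := symTSPCenter n
  set h := s - f c with hh
  have hpos : 0 < h := sub_pos.2 (hf c (center_mem_symTSP hn4))
  have hlt : ∀ g, f (tourVec g) < h := fun g => by
    have := hf _ (tour_mem_symTSP g)
    rw [map_add] at this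
    linarith
  have hgt : ∀ g, -(2 / ((n : ℝ) - 3) * f (tourVec g)) < h := fun g => by
    have := hf _ (reflect_tour_mem hn g)
    rw [map_sub, map_smul, smul_eq_mul] at this
    linarith
  have hsum : ∑ g : Equiv.Perm (Fin n), f (tourVec g) = 0 := by
    rw [← map_sum, sum_tourVec hn4, map_zero]
  have hsq : ∑ g : Equiv.Perm (Fin n), f (tourVec g) ^ 2 = κ * ‖a‖ ^ 2 := by
    rw [Submodule.coe_norm, ← hframe a a.2]
    exact Finset.sum_congr rfl fun g _ => by rw [← ha _ (tourVec_mem hn4 g), real_inner_comm]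
  -- The linear terms cancel in the sum, leaving h² against α times the mean of f².
  have hnonneg : 0 ≤ ∑ g : Equiv.Perm (Fin n),
      (h - f (tourVec g)) * (h + 2 / ((n : ℝ) - 3) * f (tourVec g)) :=
    Finset.sum_nonneg fun g _ => mul_nonneg (by linarith [hlt g]) (by linarith [hgt g])
  have hexp : ∀ g : Equiv.Perm (Fin n),
      (h - f (tourVec g)) * (h + 2 / ((n : ℝ) - 3) * f (tourVec g)) =
      h ^ 2 + (2 / ((n : ℝ) - 3) - 1) * h * f (tourVec g) -
        2 / ((n : ℝ) - 3) * f (tourVec g) ^ 2 := fun g => by ring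
  simp only [hexp, Finset.sum_sub_distrib, Finset.sum_add_distrib, ← Finset.mul_sum, hsum, hsq,
    Finset.sum_const, Finset.card_univ, nsmul_eq_mul, mul_zero, add_zero] at hnonneg
  have htr := tour_frame_constant hn4 hframe
  rw [finrank_tspDirection hn4] at htr
  set m := ((Fintype.card (Equiv.Perm (Fin n)) : ℕ) : ℝ)
  have hm : 0 < m := by simp only [m]; exact_mod_cast Fintype.card_pos
  have hκ' : 2 / ((n : ℝ) - 3) * κ = m * (8 / (((n : ℝ) - 1) * ((n : ℝ) - 3))) := by
    have hn0 : (n : ℝ) ≠ 0 := by linarith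
    field_simp at htr ⊢
    linarith
  have hbound : 8 / (((n : ℝ) - 1) * ((n : ℝ) - 3)) * ‖a‖ ^ 2 ≤ h ^ 2 := by
    rw [← mul_assoc, hκ', mul_assoc, ← mul_sub] at hnonneg
    linarith [nonneg_of_mul_nonneg_right hnonneg hm]
  have hle : Real.sqrt (8 / (((n : ℝ) - 1) * ((n : ℝ) - 3))) * ‖a‖ ≤ h := by
    refine abs_le_of_sq_le_sq' ?_ hpos.le |>.2
    rwa [mul_pow, Real.sq_sqrt (by positivity)]
  have hcs : f (x - c) ≤ ‖a‖ * ‖x - c‖ := by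
    rw [← ha _ hx]; exact real_inner_le_norm _ _
  have : f (x - c) ≤ h := hcs.trans <| (mul_le_mul_of_nonneg_left hd (norm_nonneg _)).trans <| by
    rwa [mul_comm]
  rw [map_sub] at this
  linarith

/-- The facet normals `-(n - 1) / 2 • coordVec i j` as elements of the direction. -/
noncomputable def facetVec (hn : 4 ≤ n) (p : {p : Fin n × Fin n // p.1 ≠ p.2}) : tspDirection n :=
  (-(((n : ℝ) - 1) / 2)) • ⟨coordVec p.1.1 p.1.2, coordVec_mem hn p.2⟩

/-- The scale makes ⟨u, x - c⟩ ≤ 1 equivalent to nonnegativity of the entry of x at p. -/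
theorem inner_facetVec (hn : 4 ≤ n) (p : {p : Fin n × Fin n // p.1 ≠ p.2}) (x : tspDirection n) :
    inner ℝ (facetVec hn p) x = -(((n : ℝ) - 1) / 2) * (x : MatSpace n) p.1 := by
  rw [Submodule.coe_inner, facetVec, Submodule.coe_smul, real_inner_smul_left,
    inner_coordVec _ _ x.2]

theorem norm_facetVec (hn : 4 ≤ n) (p : {p : Fin n × Fin n // p.1 ≠ p.2}) :
    ‖facetVec hn p‖ = (Real.sqrt (8 / (((n : ℝ) - 1) * ((n : ℝ) - 3))))⁻¹ := by
  have hn' : (4 : ℝ) ≤ n := by exact_mod_cast hn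
  have h3 : (0 : ℝ) < n - 3 := by linarith
  have h1 : (0 : ℝ) < n - 1 := by linarith
  rw [← Real.sqrt_inv, eq_comm, Real.sqrt_eq_iff_mul_self_eq (by positivity) (norm_nonneg _), ← sq,
    facetVec, norm_smul, mul_pow, Submodule.coe_norm, norm_sq_coordVec hn p.2, Real.norm_eq_abs,
    sq_abs]
  field_simp
  ring

theorem sum_offDiag_eq {f : Fin n × Fin n → ℝ} (hf : ∀ i, f (i, i) = 0) :
    ∑ p : {p : Fin n × Fin n // p.1 ≠ p.2}, f p = ∑ i, ∑ j, f (i, j) := by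
  rw [← Fintype.sum_prod_type, ← Finset.sum_subtype (Finset.univ.filter fun p => p.1 ≠ p.2)
    (by simp) f]
  refine Finset.sum_filter_of_ne ?_
  rintro ⟨i, j⟩ - h hij
  obtain rfl : i = j := hij
  exact h (hf i)

/-- The square norm of the sum s is a multiple of the sum of all entries of s, which is zero in W.
-/
theorem sum_facetVec (hn : 4 ≤ n) : ∑ p, facetVec hn p = 0 := by
  rw [← inner_self_eq_zero (𝕜 := ℝ)]
  nth_rewrite 1 [sum_inner]
  simp only [inner_facetVec, ← Finset.mul_sum]
  set s := ∑ p, facetVec hn p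
  rw [sum_offDiag_eq (f := fun p => (s : MatSpace n) p) s.2.2.1]
  simp [s.2.2.2]

theorem facet_frame (hn : 4 ≤ n) (x : tspDirection n) :
    ∑ p, inner ℝ (facetVec hn p) x ^ 2 = (((n : ℝ) - 1) / 2) ^ 2 * ‖x‖ ^ 2 := by
  simp only [inner_facetVec, mul_pow, ← Finset.mul_sum, neg_sq]
  rw [sum_offDiag_eq (f := fun p => (x : MatSpace n) p ^ 2) (fun i => by rw [x.2.2.1]; simp),
    Submodule.coe_norm, MatSpace.norm_sq_eq]

theorem symTSP_subset_ball (hn : 4 ≤ n) : symTSP n ⊆ ballInHull (symTSP n) (symTSPCenter n)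
    (Real.sqrt (2 * n * ((n : ℝ) - 3) / ((n : ℝ) - 1))) := by
  intro x hx
  refine ⟨subset_affineSpan ℝ _ hx, ?_⟩
  have : symTSP n ⊆ Metric.closedBall (symTSPCenter n)
      (Real.sqrt (2 * n * ((n : ℝ) - 3) / ((n : ℝ) - 1))) := by
    rw [symTSP_eq]
    refine convexHull_min ?_ (convex_closedBall _ _)
    rintro _ ⟨g, rfl⟩
    rw [Metric.mem_closedBall, dist_eq_norm, add_sub_cancel_left]
    exact Real.le_sqrt_of_sq_le (norm_sq_tourVec hn g).le
  exact this hx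

theorem isMinVolEllipsoid_symTSP_iff (hn : 4 ≤ n) (E : Set (MatSpace n)) :
    IsMinVolEllipsoid (symTSP n) E ↔ E = ballInHull (symTSP n) (symTSPCenter n)
        (Real.sqrt (2 * n * ((n : ℝ) - 3) / ((n : ℝ) - 1))) := by
  have hn' : (4 : ℝ) ≤ n := by exact_mod_cast hn
  have h3 : (0 : ℝ) < n - 3 := by linarith
  have h1 : (0 : ℝ) < n - 1 := by linarith
  have hc := subset_affineSpan ℝ _ (center_mem_symTSP hn)
  have hr : 0 < Real.sqrt (2 * n * ((n : ℝ) - 3) / ((n : ℝ) - 1)) := by positivity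
  refine isMinVolEllipsoid_iff_ball hc hr (symTSP_subset_ball hn) ?_ E
  obtain ⟨κ, -, -, hframe⟩ := exists_tour_tight_frame hn
  have hfin := finrank_tspDirection_pos hn
  have hmem : ∀ g, tourVec g ∈ (affineSpan ℝ (symTSP n)).direction := fun g => by
    rw [direction_symTSP hn]; exact tourVec_mem hn g
  have hsub : ∀ x : (affineSpan ℝ (symTSP n)).direction, (x : MatSpace n) ∈ tspDirection n :=
    fun x => by rw [← direction_symTSP hn]; exact x.2
  rw [← direction_symTSP hn] at hfin
  intro p hp T hT
  have hq := AffineSubspace.vsub_mem_direction hp hc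
  obtain ⟨h5, h6⟩ := ellipsoid_containing_tight_frame
    (y := fun g => (⟨tourVec g, hmem g⟩ : (affineSpan ℝ (symTSP n)).direction)) (κ := κ) hr hfin
    (fun g => by
      rw [Submodule.coe_norm, eq_comm, Real.sqrt_eq_iff_mul_self_eq (by positivity) (norm_nonneg _),
        ← sq, norm_sq_tourVec hn])
    (by ext1; simpa using sum_tourVec hn)
    (fun x => hframe x (hsub x)) T ⟨p - symTSPCenter n, hq⟩ (fun g => by
      obtain ⟨w, hw, hw'⟩ := hT (tour_mem_symTSP g)
      have h7 : T w = ⟨tourVec g, hmem g⟩ - ⟨p - symTSPCenter n, hq⟩ := by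
        ext1
        simp only [Submodule.coe_sub]
        rw [eq_sub_of_add_eq' hw']
        abel
      rw [← h7, LinearEquiv.symm_apply_apply]
      simpa using hw)
  refine ⟨h5, fun h => ?_⟩
  obtain ⟨h8, h9⟩ := h6 h
  exact ⟨sub_eq_zero.1 (congrArg Subtype.val h8), h9⟩

theorem isMaxVolEllipsoid_symTSP_iff (hn : 5 ≤ n) (E : Set (MatSpace n)) :
    IsMaxVolEllipsoid (symTSP n) E ↔ E = ballInHull (symTSP n) (symTSPCenter n)
        (Real.sqrt (8 / (((n : ℝ) - 1) * ((n : ℝ) - 3)))) := by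
  have hn4 : 4 ≤ n := by lia
  have hn' : (4 : ℝ) ≤ n := by exact_mod_cast hn4
  have h3 : (0 : ℝ) < n - 3 := by linarith
  have h1 : (0 : ℝ) < n - 1 := by linarith
  have hc := subset_affineSpan ℝ _ (center_mem_symTSP hn4)
  have hr : 0 < Real.sqrt (8 / (((n : ℝ) - 1) * ((n : ℝ) - 3))) := by positivity
  refine isMaxVolEllipsoid_iff_ball hc hr (ball_subset_symTSP hn) ?_ E
  have hne : Nonempty {p : Fin n × Fin n // p.1 ≠ p.2} :=
    ⟨⟨(⟨0, by lia⟩, ⟨1, by lia⟩), by simp⟩⟩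
  -- The type of T depends on the direction; a variable U allows substituting `tspDirection n` for
  -- it.
  have main : ∀ U : Submodule ℝ (MatSpace n), U = tspDirection n → ∀ T : U ≃ₗ[ℝ] U, ∀ p,
      p - symTSPCenter n ∈ U → (∀ w : U, ‖w‖ ≤ 1 → p + (T w : MatSpace n) ∈ symTSP n) →
      |LinearMap.det (T : U →ₗ[ℝ] U)| ≤
          Real.sqrt (8 / (((n : ℝ) - 1) * ((n : ℝ) - 3))) ^ finrank ℝ U ∧
        (Real.sqrt (8 / (((n : ℝ) - 1) * ((n : ℝ) - 3))) ^ finrank ℝ U ≤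
          |LinearMap.det (T : U →ₗ[ℝ] U)| → p = symTSPCenter n ∧
            ∀ w, ‖T w‖ = Real.sqrt (8 / (((n : ℝ) - 1) * ((n : ℝ) - 3))) * ‖w‖) := by
    rintro _ rfl T p hq hT
    obtain ⟨h5, h6⟩ := ellipsoid_inside_tight_frame hr (finrank_tspDirection_pos hn4)
      (norm_facetVec hn4) (sum_facetVec hn4) (facet_frame hn4) T ⟨p - symTSPCenter n, hq⟩
      (fun e w hw => by
        have h7 := symTSP_nonneg (hT w hw) e.1.1 e.1.2
        rw [inner_facetVec]
        have h8 : ((⟨p - symTSPCenter n, hq⟩ + T w : tspDirection n) : MatSpace n) e.1 =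
            (p + (T w : MatSpace n)) e.1 - 2 / ((n : ℝ) - 1) := by
          have h9 : symTSPCenter n e.1 = 2 / ((n : ℝ) - 1) := if_neg e.2
          simp only [Submodule.coe_add, PiLp.add_apply, PiLp.sub_apply, h9]
          ring
        rw [h8]
        have h10 : -(((n : ℝ) - 1) / 2) * ((p + (T w : MatSpace n)) e.1 - 2 / ((n : ℝ) - 1)) =
            1 - ((n : ℝ) - 1) / 2 * (p + (T w : MatSpace n)) e.1 := by
          field_simp
          ring
        rw [h10]
        have : 0 ≤ ((n : ℝ) - 1) / 2 * (p + (T w : MatSpace n)) e.1 :=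
          mul_nonneg (by positivity) h7
        linarith)
    refine ⟨h5, fun h => ?_⟩
    obtain ⟨h8, h9⟩ := h6 h
    exact ⟨sub_eq_zero.1 (congrArg Subtype.val h8), h9⟩
  intro p hp T hT
  exact main _ (direction_symTSP hn4) T p (AffineSubspace.vsub_mem_direction hp hc) fun w hw =>
    hT ⟨w, by simpa using hw, rfl⟩

end TSP

theorem mainTheorem3 (n : ℕ) (hn : 4 ≤ n) :
    -- the affine hull and the dimension of the polytope
    (∀ x : MatSpace n, x ∈ affineSpan ℝ (symTSP n) ↔
      (∀ i j, x (i, j) = x (j, i)) ∧ (∀ i, x (i, i) = 0) ∧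
        (∀ i, ∑ j, x (i, j) = 2) ∧ (∀ j, ∑ i, x (i, j) = 2)) ∧
    (finrank ℝ (affineSpan ℝ (symTSP n)).direction : ℝ) = ((n : ℝ) ^ 2 - 3 * n) / 2 ∧
    -- the unique minimum volume ellipsoid
    (∀ E : Set (MatSpace n), IsMinVolEllipsoid (symTSP n) E ↔
      E = ballInHull (symTSP n) (symTSPCenter n)
        (Real.sqrt (2 * n * ((n : ℝ) - 3) / ((n : ℝ) - 1)))) ∧
    -- the symmetry coefficient and the unique maximum volume ellipsoid
    (5 ≤ n →
      IsSymmetryCoefficient (symTSP n) (symTSPCenter n) (2 / ((n : ℝ) - 3)) ∧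
      ∀ E : Set (MatSpace n), IsMaxVolEllipsoid (symTSP n) E ↔
        E = ballInHull (symTSP n) (symTSPCenter n)
          (Real.sqrt (8 / (((n : ℝ) - 1) * ((n : ℝ) - 3))))) := by
  refine ⟨mem_affineSpan_symTSP_iff hn, ?_, isMinVolEllipsoid_symTSP_iff hn, fun hn5 =>
    ⟨isSymmetryCoefficient_symTSP hn5, isMaxVolEllipsoid_symTSP_iff hn5⟩⟩
  rw [direction_symTSP hn, finrank_tspDirection hn]
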